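/- A $3$-graph ($3$-uniform hypergraph) is a pair $H=(V,E)$ with $V$ a finite set and $E\subseteq\binom V3$. A set $S\subseteq V$ is homogeneous if either every $3$-subset of $S$ belongs to $E$ or no $3$-subset of $S$ belongs to $E$; let $h(H)$ be the size of a largest homogeneous set of $H$. For $f\in\{0,\dots,4\}$, call $H$ $(4,f)$-free if no four vertices of $H$ span exactly $f$ edges, and let $h_3(n,4,f)$ be the minimum of $h(H)$ over all $(4,f)$-free $3$-graphs $H$ with $n$ vertices. Proposition. There are positive constants $c_1,c_2$ such that $$h_3(n,4,1)>c_1\left(\frac{\log n}{\log\log n}\right)^{1/2}\qquad\text{for every integer } n\ge 3,$$ and $$n^{c_1}<h_3(n,4,2)<c_2\,n^{1/3}(\log n)^{4/3}\qquad\text{for every integer } n\ge 2.$$ -/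

import Mathlib

/-- An `r`-uniform hypergraph (`r`-graph) on the vertex set `V`. -/
structure RGraph (r : ℕ) (V : Type*) where
  /-- The edge set. -/
  edges : Finset (Finset V)
  /-- Every edge has exactly `r` vertices. -/
  card_of_mem : ∀ e ∈ edges, e.card = r

namespace RGraph

variable {r : ℕ} {V : Type*}

/-- `S` is a clique: every `r`-subset of `S` is an edge. -/
def IsClique (H : RGraph r V) (S : Finset V) : Prop :=
  ∀ e : Finset V, e ⊆ S → e.card = r → e ∈ H.edges

/-- `S` is a coclique (independent set): no `r`-subset of `S` is an edge. -/
def IsCoclique (H : RGraph r V) (S : Finset V) : Prop :=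
  ∀ e : Finset V, e ⊆ S → e.card = r → e ∉ H.edges

/-- `S` is homogeneous: it is a clique or a coclique. -/
def IsHomogeneous (H : RGraph r V) (S : Finset V) : Prop :=
  H.IsClique S ∨ H.IsCoclique S

open Classical in
/-- `h(H)`: the size of a largest homogeneous set of `H`. -/
noncomputable def homNumber [Fintype V] (H : RGraph r V) : ℕ :=
  (Finset.univ.filter fun S : Finset V => H.IsHomogeneous S).sup Finset.card

/-- The edges of the subgraph of `H` induced by `S`. -/
def inducedEdges [DecidableEq V] (H : RGraph r V) (S : Finset V) : Finset (Finset V) :=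
  H.edges.filter fun e => e ⊆ S

/-- `H` is `(m, f)`-free: no `m` vertices of `H` induce exactly `f` edges, that is, `H` has no
induced subgraph with `m` vertices and `f` edges. -/
def IsOrderSizeFree [DecidableEq V] (H : RGraph r V) (m f : ℕ) : Prop :=
  ∀ S : Finset V, S.card = m → (H.inducedEdges S).card ≠ f

/-- `H` is `Q`-free: it is `(m, f)`-free for every order-size pair `(m, f)` in `Q`. -/
def IsFree [DecidableEq V] (H : RGraph r V) (Q : Set (ℕ × ℕ)) : Prop :=
  ∀ p ∈ Q, H.IsOrderSizeFree p.1 p.2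

end RGraph

/-- `h_r(n, Q)`: the minimum of `h(H)` over all `Q`-free `r`-graphs `H` on `n` vertices.
(Every `n`-vertex `r`-graph is isomorphic to one with vertex set `Fin n`.) -/
noncomputable def minHomNumber (r n : ℕ) (Q : Set (ℕ × ℕ)) : ℕ :=
  sInf {k : ℕ | ∃ H : RGraph r (Fin n), H.IsFree Q ∧ H.homNumber = k}

/-! Edges are treated as a symmetric ternary predicate `E`; the three bounds have separate proofs.

Lower bound for (4,1). Suppose all homogeneous sets have size at most s. If uwv and uwx are
non-edges, then uvx and wvx are both edges or both not, since otherwise u, w, v, x span exactly one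
edge (`NoOne.iff_of_not`). Hence vertices can be picked one by one into a rooted forest in which
every vertex acts on the remaining candidates as the root of its tree does. A new vertex v becomes
the parent of the roots with which it forms non-edges. Vertices of equal height form a clique, and a
root of height d tops a coclique with more than d vertices. So s^2 + 1 picked vertices are
impossible. A root is charged a factor about s + 1 only once, when it gets a parent, so the
candidates last for s^2 + 1 picks unless N ≤ (6(s+1))^(s^2).

Lower bound for (4,2). The condition is invariant under complement and forbids an induced P₄ in
every link. An induced 2K₂ in a link (a `Bowtie`) is determined by its four outer vertices, so there
are at most N^4 of them, and likewise for C₄, the complementary case. A random set of about N^(1/5)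
vertices therefore avoids both. There all links are threshold graphs, and the set splits into two
parts whose crossing triples are all edges or all non-edges (`exists_holdsAcross`). Recursion, as
for cographs, gives |W| ≤ |clique| · |coclique|.

Upper bound for (4,2). Collinear triples of points in a finite plane form a (4,2)-free graph: two
collinear triples among four points share two points and force all four onto one line. Cliques lie
on lines, and cocliques are arcs. A container argument covers the large arcs by few sets of size
O(q), and a union bound over random n-subsets of the plane leaves no large line section or arc. -/

/-! ### Edges as symmetric ternary predicates. -/

/-- The edge relation of a `3`-graph as a ternary predicate. -/
def RGraph.Adj3 {V : Type*} [DecidableEq V] (H : RGraph 3 V) (x y z : V) : Prop :=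
  ({x, y, z} : Finset V) ∈ H.edges

/-- A ternary predicate invariant under permutation of its arguments. -/
structure Symm3 {V : Type*} (E : V → V → V → Prop) : Prop where
  swap12 : ∀ ⦃x y z⦄, E x y z → E y x z
  swap23 : ∀ ⦃x y z⦄, E x y z → E x z y

/-- The predicate holds on all triples of distinct elements of `S`. -/
def HoldsOn {V : Type*} (E : V → V → V → Prop) (S : Finset V) : Prop :=
  ∀ x ∈ S, ∀ y ∈ S, ∀ z ∈ S, x ≠ y → x ≠ z → y ≠ z → E x y z

/-- The complementary predicate. -/
def Compl3 {V : Type*} (E : V → V → V → Prop) (x y z : V) : Prop := ¬ E x y z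

/-- No four vertices span exactly one triple of `E`. -/
def NoOne {V : Type*} (E : V → V → V → Prop) : Prop :=
  ∀ a b c d, a ≠ b → a ≠ c → a ≠ d → b ≠ c → b ≠ d → c ≠ d →
    E a b c → E a b d ∨ E a c d ∨ E b c d

/-- No four vertices span exactly two triples of `E`. -/
def NoTwo {V : Type*} (E : V → V → V → Prop) : Prop :=
  ∀ a b c d, a ≠ b → a ≠ c → a ≠ d → b ≠ c → b ≠ d → c ≠ d →
    E a b c → E a b d → E a c d ∨ E b c d

theorem Symm3.compl {V : Type*} {E : V → V → V → Prop} (h : Symm3 E) : Symm3 (Compl3 E) :=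
  ⟨fun _ _ _ he hf => he (h.swap12 hf), fun _ _ _ he hf => he (h.swap23 hf)⟩

theorem Symm3.rot {V : Type*} {E : V → V → V → Prop} (h : Symm3 E) {x y z : V}
    (he : E x y z) : E y z x :=
  h.swap23 (h.swap12 he)

theorem Symm3.compl_compl {V : Type*} (E : V → V → V → Prop) : Compl3 (Compl3 E) = E := by
  funext x y z
  simp [Compl3]

/-- Four vertices carry four triples, so exactly two edges is the same as exactly two non-edges. -/
theorem NoTwo.compl {V : Type*} {E : V → V → V → Prop} (hs : Symm3 E) (h : NoTwo E) :
    NoTwo (Compl3 E) := by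
  intro a b c d hab hac had hbc hbd hcd h1 h2
  by_contra hcon
  simp only [Compl3, not_or, not_not] at hcon h1 h2
  obtain ⟨h3, h4⟩ := hcon
  rcases h c d a b hcd hac.symm hbc.symm had.symm hbd.symm hab (hs.rot h3) (hs.rot h4) with h5 | h5
  · exact h1 (hs.rot h5)
  · exact h2 (hs.rot h5)

theorem HoldsOn.mono {V : Type*} {E : V → V → V → Prop} {S T : Finset V} (h : HoldsOn E T)
    (hST : S ⊆ T) : HoldsOn E S :=
  fun x hx y hy z hz => h x (hST hx) y (hST hy) z (hST hz)

/-! ### Passage between 3-graphs and predicates; attainment of the minimum. -/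

section RGraph

variable {V : Type*} [DecidableEq V]

theorem RGraph.symm3_adj3 (H : RGraph 3 V) : Symm3 H.Adj3 := by
  constructor
  · intro x y z h
    have : ({y, x, z} : Finset V) = {x, y, z} := by
      ext; simp only [Finset.mem_insert, Finset.mem_singleton]; tauto
    simpa only [RGraph.Adj3, this] using h
  · intro x y z h
    have : ({x, z, y} : Finset V) = {x, y, z} := by
      ext; simp only [Finset.mem_insert, Finset.mem_singleton]; tauto
    simpa only [RGraph.Adj3, this] using h

theorem RGraph.isClique_of_holdsOn (H : RGraph 3 V) {S : Finset V} (h : HoldsOn H.Adj3 S) :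
    H.IsClique S := by
  intro e he hc
  obtain ⟨x, y, z, hxy, hxz, hyz, rfl⟩ := Finset.card_eq_three.1 hc
  exact h x (he (by simp)) y (he (by simp)) z (he (by simp)) hxy hxz hyz

theorem RGraph.isCoclique_of_holdsOn (H : RGraph 3 V) {S : Finset V}
    (h : HoldsOn (Compl3 H.Adj3) S) : H.IsCoclique S := by
  intro e he hc
  obtain ⟨x, y, z, hxy, hxz, hyz, rfl⟩ := Finset.card_eq_three.1 hc
  exact h x (he (by simp)) y (he (by simp)) z (he (by simp)) hxy hxz hyz

theorem Finset.eq_triple_of_subset_quadruple {a b c d : V} (hab : a ≠ b) (hac : a ≠ c)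
    (had : a ≠ d) (hbc : b ≠ c) (hbd : b ≠ d) (hcd : c ≠ d) {e : Finset V}
    (he : e ⊆ {a, b, c, d}) (hc : e.card = 3) :
    e = {a, b, c} ∨ e = {a, b, d} ∨ e = {a, c, d} ∨ e = {b, c, d} := by
  have hS : ({a, b, c, d} : Finset V).card = 4 := by
    rw [Finset.card_eq_succ]
    exact ⟨a, {b, c, d}, by simp [*], rfl, Finset.card_eq_three.2 ⟨b, c, d, hbc, hbd, hcd, rfl⟩⟩
  obtain ⟨x, hx, hxe⟩ := Finset.exists_mem_notMem_of_card_lt_card (s := e)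
    (t := {a, b, c, d}) (by omega)
  have hee : e = ({a, b, c, d} : Finset V).erase x := by
    apply Finset.eq_of_subset_of_card_le
    · intro y hy
      exact Finset.mem_erase.2 ⟨fun h => hxe (h ▸ hy), he hy⟩
    · rw [Finset.card_erase_of_mem hx]; omega
  simp only [Finset.mem_insert, Finset.mem_singleton] at hx
  rcases hx with rfl | rfl | rfl | rfl
  · right; right; right; rw [hee]; ext y; simp only [Finset.mem_erase, Finset.mem_insert,
      Finset.mem_singleton]; grind
  · right; right; left; rw [hee]; ext y; simp only [Finset.mem_erase, Finset.mem_insert,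
      Finset.mem_singleton]; grind
  · right; left; rw [hee]; ext y; simp only [Finset.mem_erase, Finset.mem_insert,
      Finset.mem_singleton]; grind
  · left; rw [hee]; ext y; simp only [Finset.mem_erase, Finset.mem_insert,
      Finset.mem_singleton]; grind

theorem RGraph.noOne_adj3 {H : RGraph 3 V} (h : H.IsFree {(4, 1)}) : NoOne H.Adj3 := by
  intro a b c d hab hac had hbc hbd hcd h1
  by_contra hcon
  simp only [not_or] at hcon
  obtain ⟨h2, h3, h4⟩ := hcon
  have hS : ({a, b, c, d} : Finset V).card = 4 := by
    rw [Finset.card_eq_succ]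
    exact ⟨a, {b, c, d}, by simp [*], rfl, Finset.card_eq_three.2 ⟨b, c, d, hbc, hbd, hcd, rfl⟩⟩
  refine h (4, 1) rfl {a, b, c, d} hS ?_
  rw [Finset.card_eq_one]
  refine ⟨{a, b, c}, ?_⟩
  ext e
  simp only [RGraph.inducedEdges, Finset.mem_filter, Finset.mem_singleton]
  constructor
  · rintro ⟨he, hsub⟩
    rcases Finset.eq_triple_of_subset_quadruple hab hac had hbc hbd hcd hsub
      (H.card_of_mem e he) with rfl | rfl | rfl | rfl
    · rfl
    · exact absurd he h2
    · exact absurd he h3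
    · exact absurd he h4
  · rintro rfl
    refine ⟨h1, ?_⟩
    intro y; simp only [Finset.mem_insert, Finset.mem_singleton]; tauto

theorem RGraph.noTwo_adj3 {H : RGraph 3 V} (h : H.IsFree {(4, 2)}) : NoTwo H.Adj3 := by
  intro a b c d hab hac had hbc hbd hcd h1 h2
  by_contra hcon
  simp only [not_or] at hcon
  obtain ⟨h3, h4⟩ := hcon
  have hS : ({a, b, c, d} : Finset V).card = 4 := by
    rw [Finset.card_eq_succ]
    exact ⟨a, {b, c, d}, by simp [*], rfl, Finset.card_eq_three.2 ⟨b, c, d, hbc, hbd, hcd, rfl⟩⟩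
  refine h (4, 2) rfl {a, b, c, d} hS ?_
  rw [Finset.card_eq_two]
  refine ⟨{a, b, c}, {a, b, d}, ?_, ?_⟩
  · intro heq
    have : c ∈ ({a, b, d} : Finset V) := heq ▸ (by simp)
    simp only [Finset.mem_insert, Finset.mem_singleton] at this
    grind
  ext e
  simp only [RGraph.inducedEdges, Finset.mem_filter, Finset.mem_singleton, Finset.mem_insert]
  constructor
  · rintro ⟨he, hsub⟩
    rcases Finset.eq_triple_of_subset_quadruple hab hac had hbc hbd hcd hsub
      (H.card_of_mem e he) with rfl | rfl | rfl | rfl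
    · exact Or.inl rfl
    · exact Or.inr rfl
    · exact absurd he h3
    · exact absurd he h4
  · rintro (rfl | rfl)
    · refine ⟨h1, ?_⟩
      intro y; simp only [Finset.mem_insert, Finset.mem_singleton]; tauto
    · refine ⟨h2, ?_⟩
      intro y; simp only [Finset.mem_insert, Finset.mem_singleton]; tauto

theorem RGraph.card_le_homNumber [Fintype V] (H : RGraph 3 V) {S : Finset V}
    (h : HoldsOn H.Adj3 S ∨ HoldsOn (Compl3 H.Adj3) S) : S.card ≤ H.homNumber := by
  classical
  unfold RGraph.homNumber
  apply Finset.le_sup (f := Finset.card)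
  simp only [Finset.mem_filter, Finset.mem_univ, true_and]
  exact h.imp H.isClique_of_holdsOn H.isCoclique_of_holdsOn

theorem RGraph.two_le_homNumber [Fintype V] (H : RGraph 3 V) (hV : 2 ≤ Fintype.card V) :
    2 ≤ H.homNumber := by
  obtain ⟨S, -, hS⟩ := Finset.exists_subset_card_eq (s := (Finset.univ : Finset V)) (n := 2) hV
  rw [← hS]
  apply H.card_le_homNumber
  left
  intro x hx y hy z hz hxy hxz hyz
  have : ({x, y, z} : Finset V).card ≤ S.card := by
    apply Finset.card_le_card
    intro w; simp only [Finset.mem_insert, Finset.mem_singleton]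
    rintro (rfl | rfl | rfl) <;> assumption
  rw [Finset.card_eq_three.2 ⟨x, y, z, hxy, hxz, hyz, rfl⟩] at this
  omega

end RGraph

theorem RGraph.homNumber_le_card {V : Type*} [Fintype V] (H : RGraph 3 V) :
    H.homNumber ≤ Fintype.card V := by
  unfold RGraph.homNumber
  exact Finset.sup_le fun S _ => Finset.card_le_univ S

/-- For pairs with a positive number of edges, the minimum in `minHomNumber` is attained. -/
theorem exists_homNumber_eq_minHomNumber (n m f : ℕ) (hf : f ≠ 0) :
    ∃ H : RGraph 3 (Fin n), H.IsFree {(m, f)} ∧ H.homNumber = minHomNumber 3 n {(m, f)} := by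
  have hne : {k : ℕ | ∃ H : RGraph 3 (Fin n), H.IsFree {(m, f)} ∧ H.homNumber = k}.Nonempty := by
    -- The edgeless graph is free because f ≠ 0. Nonemptiness matters: `sInf` of the empty set would
    -- be 0.
    refine ⟨_, ⟨∅, by simp⟩, ?_, rfl⟩
    rintro p rfl S -
    simpa [RGraph.inducedEdges] using hf.symm
  exact Nat.sInf_mem hne

theorem minHomNumber_le_homNumber {n : ℕ} {Q : Set (ℕ × ℕ)} (H : RGraph 3 (Fin n))
    (h : H.IsFree Q) : minHomNumber 3 n Q ≤ H.homNumber :=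
  Nat.sInf_le ⟨H, h, rfl⟩

/-! ### (4,1)-free graphs: the forest argument. -/

section NoOne

variable {V : Type*}

/-- `E` holds on `C` and on all triples with two elements in `C` and one in `A`. -/
def HoldsWith (E : V → V → V → Prop) (C A : Finset V) : Prop :=
  HoldsOn E C ∧ ∀ u ∈ C, ∀ w ∈ C, u ≠ w → ∀ x ∈ A, E u w x

theorem HoldsWith.mono {E : V → V → V → Prop} {C A A' : Finset V} (h : HoldsWith E C A)
    (hA : A' ⊆ A) : HoldsWith E C A' :=
  ⟨h.1, fun u hu w hw huw x hx => h.2 u hu w hw huw x (hA hx)⟩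

/-- If just one of the two triples were an edge, it would be the only edge on u, w, v, x. -/
theorem NoOne.iff_of_not {E : V → V → V → Prop} (hs : Symm3 E) (h1 : NoOne E) {u w v x : V}
    (huw : u ≠ w) (huv : u ≠ v) (hux : u ≠ x) (hwv : w ≠ v) (hwx : w ≠ x) (hvx : v ≠ x)
    (h3 : ¬ E u w v) (h4 : ¬ E u w x) : E u v x ↔ E w v x := by
  constructor
  · intro h
    rcases h1 u v x w huv hux huw hvx hwv.symm hwx.symm h with h5 | h5 | h5
    · exact absurd (hs.swap23 h5) h3
    · exact absurd (hs.swap23 h5) h4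
    · exact hs.rot (hs.rot h5)
  · intro h
    rcases h1 w v x u hwv hwx huw.symm hvx huv.symm hux.symm h with h5 | h5 | h5
    · exact absurd (hs.swap12 (hs.swap23 h5)) h3
    · exact absurd (hs.swap12 (hs.swap23 h5)) h4
    · exact hs.rot (hs.rot h5)

variable [DecidableEq V]

theorem HoldsWith.insert {E : V → V → V → Prop} (hs : Symm3 E) {C A A' : Finset V}
    (h : HoldsWith E C A) {v : V} (hv : v ∈ A) (hA : A' ⊆ A)
    (hE : ∀ u ∈ C, ∀ x ∈ A', E u v x) : HoldsWith E (insert v C) A' := by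
  constructor
  · intro x hx y hy z hz hxy hxz hyz
    rw [Finset.mem_insert] at hx hy hz
    rcases hx with rfl | hx
    · have hy := hy.resolve_left hxy.symm
      have hz := hz.resolve_left hxz.symm
      exact hs.rot (hs.rot (h.2 y hy z hz hyz x hv))
    · rcases hy with rfl | hy
      · have hz := hz.resolve_left hyz.symm
        exact hs.swap23 (h.2 x hx z hz hxz y hv)
      · rcases hz with rfl | hz
        · exact h.2 x hx y hy hxy z hv
        · exact h.1 x hx y hy z hz hxy hxz hyz
  · intro u hu w hw huw x hx
    rw [Finset.mem_insert] at hu hw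
    rcases hu with rfl | hu
    · exact hs.swap12 (hE w (hw.resolve_left huw.symm) x hx)
    · rcases hw with rfl | hw
      · exact hE u hu x hx
      · exact h.2 u hu w hw huw x (hA hx)

/-- The elements of R are treated in turn, each time keeping the candidates of one type. Failure of
`P` is chosen when it retains a proportion at least 1/(s+1), and otherwise `P` retains at least
s/(s+1). The choice is lopsided because elements put into `Z` cease to be roots and are paid for
only once. -/
theorem exists_split (P : V → V → Prop) (s : ℕ) (R A : Finset V) :
    ∃ Z ⊆ R, ∃ B ⊆ A, (∀ w ∈ Z, ∀ x ∈ B, ¬ P w x) ∧ (∀ w ∈ R \ Z, ∀ x ∈ B, P w x) ∧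
      A.card * s ^ (R \ Z).card ≤ B.card * (s + 1) ^ R.card := by
  classical
  induction R using Finset.induction_on with
  | empty => exact ⟨∅, by simp, A, by simp, by simp, by simp, by simp⟩
  | insert r R hr ih =>
    obtain ⟨Z, hZ, B, hB, h0, h1, hc⟩ := ih
    have hrZ : r ∉ Z := fun h => hr (hZ h)
    have hsplit := Finset.card_filter_add_card_filter_not (s := B) (P r)
    rw [Finset.card_insert_of_notMem hr, pow_succ]
    by_cases hcase : B.card ≤ (B.filter fun x => ¬ P r x).card * (s + 1)
    · refine ⟨insert r Z, Finset.insert_subset_insert r hZ, B.filter fun x => ¬ P r x,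
        (Finset.filter_subset _ _).trans hB, ?_, ?_, ?_⟩
      · intro w hw x hx
        rw [Finset.mem_filter] at hx
        rcases Finset.mem_insert.1 hw with rfl | hw
        · exact hx.2
        · exact h0 w hw x hx.1
      · intro w hw x hx
        rw [Finset.mem_filter] at hx
        simp only [Finset.mem_sdiff, Finset.mem_insert, not_or] at hw
        exact h1 w (Finset.mem_sdiff.2 ⟨hw.1.resolve_left hw.2.1, hw.2.2⟩) x hx.1
      · have : insert r R \ insert r Z = R \ Z := by
          ext w; simp only [Finset.mem_sdiff, Finset.mem_insert]; grind
        rw [this]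
        calc _ ≤ B.card * (s + 1) ^ R.card := hc
          _ ≤ ((B.filter fun x => ¬ P r x).card * (s + 1)) * (s + 1) ^ R.card :=
            Nat.mul_le_mul_right _ hcase
          _ = _ := by ring
    · refine ⟨Z, hZ.trans (Finset.subset_insert _ _), B.filter fun x => P r x,
        (Finset.filter_subset _ _).trans hB, ?_, ?_, ?_⟩
      · intro w hw x hx
        exact h0 w hw x (Finset.mem_filter.1 hx).1
      · intro w hw x hx
        rw [Finset.mem_filter] at hx
        simp only [Finset.mem_sdiff, Finset.mem_insert] at hw
        rcases hw.1 with rfl | hw'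
        · exact hx.2
        · exact h1 w (Finset.mem_sdiff.2 ⟨hw', hw.2⟩) x hx.1
      · have : insert r R \ Z = insert r (R \ Z) := by
          ext w; simp only [Finset.mem_sdiff, Finset.mem_insert]; grind
        rw [this, Finset.card_insert_of_notMem (by simp [hr]), pow_succ]
        have h3 : B.card * s ≤ (B.filter fun x => P r x).card * (s + 1) := by
          push Not at hcase
          nlinarith
        calc A.card * (s ^ (R \ Z).card * s) = (A.card * s ^ (R \ Z).card) * s := by ring
          _ ≤ (B.card * (s + 1) ^ R.card) * s := Nat.mul_le_mul_right _ hc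
          _ = (B.card * s) * (s + 1) ^ R.card := by ring
          _ ≤ ((B.filter fun x => P r x).card * (s + 1)) * (s + 1) ^ R.card :=
            Nat.mul_le_mul_right _ h3
          _ = _ := by ring

/-- A rooted forest on `S` with depth function `d` and roots `R`: comparable vertices form
non-edges and incomparable ones edges with all candidates in `A`. -/
structure TripleForest (E : V → V → V → Prop) (S A R : Finset V) (d : V → ℕ) : Prop where
  disj : Disjoint S A
  sub : R ⊆ S
  roots : HoldsWith E R A
  root : ∀ u ∈ S, ∃ w ∈ R, d u ≤ d w ∧ (u = w ∨ ∀ x ∈ A, ¬ E u w x)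
  level : ∀ i, HoldsWith E (S.filter fun u => d u = i) A
  chain : ∀ w ∈ R, ∃ C ⊆ S, w ∈ C ∧ d w < C.card ∧ HoldsWith (Compl3 E) C A

/-- The vertex v becomes the parent of the roots in `Z`, one higher than the highest of them; `d` is
thus a height, with leaves at 0. If u has the same height as v, its root is at least as high, hence
not in `Z`, so u inherits edges with v from that root. For `chain`, the coclique of a highest root
in `Z` is extended by v. -/
theorem TripleForest.step {E : V → V → V → Prop} (hs : Symm3 E) (h1 : NoOne E)
    {S A R Z B : Finset V} {d : V → ℕ} (hF : TripleForest E S A R d) {v : V} (hv : v ∈ A)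
    (hB : B ⊆ A.erase v) (hZ : Z ⊆ R) (hZE : ∀ w ∈ Z, ∀ x ∈ B, ¬ E w v x)
    (hRE : ∀ w ∈ R \ Z, ∀ x ∈ B, E w v x) :
    TripleForest E (insert v S) B (insert v (R \ Z))
      (Function.update d v (Z.sup fun w => d w + 1)) := by
  have hBA : B ⊆ A := hB.trans (Finset.erase_subset _ _)
  have hvB : v ∉ B := fun h => (Finset.mem_erase.1 (hB h)).1 rfl
  have hvS : v ∉ S := fun h => Finset.disjoint_left.1 hF.disj h hv
  have hSA : ∀ {u x}, u ∈ S → x ∈ A → u ≠ x := fun hu hx h =>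
    Finset.disjoint_left.1 hF.disj hu (h ▸ hx)
  have hd : ∀ u ∈ S, Function.update d v (Z.sup fun w => d w + 1) u = d u := fun u hu =>
    Function.update_of_ne (fun h : u = v => hvS (h ▸ hu)) _ _
  have hdv : Function.update d v (Z.sup fun w => d w + 1) v = Z.sup fun w => d w + 1 :=
    Function.update_self _ _ _
  have key : ∀ u ∈ S, ∀ w ∈ S, (u = w ∨ ∀ x ∈ A, ¬ E u w x) → ∀ x ∈ B,
      (E u v x ↔ E w v x) := by
    intro u hu w hw huw x hx
    rcases huw with rfl | huw
    · rfl
    by_cases h : u = w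
    · rw [h]
    · exact h1.iff_of_not hs h (hSA hu hv) (hSA hu (hBA hx)) (hSA hw hv) (hSA hw (hBA hx))
        (fun h => hvB (h ▸ hx)) (huw v hv) (huw x (hBA hx))
  constructor
  · rw [Finset.disjoint_insert_left]
    exact ⟨hvB, hF.disj.mono_right hBA⟩
  · exact Finset.insert_subset_insert _ (Finset.sdiff_subset.trans hF.sub)
  · apply HoldsWith.insert hs (A := A) _ hv hBA hRE
    exact ⟨fun x hx y hy z hz => hF.roots.1 x (Finset.mem_sdiff.1 hx).1 y (Finset.mem_sdiff.1 hy).1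
      z (Finset.mem_sdiff.1 hz).1, fun x hx y hy => hF.roots.2 x (Finset.mem_sdiff.1 hx).1 y
      (Finset.mem_sdiff.1 hy).1⟩
  · intro u hu
    rcases Finset.mem_insert.1 hu with rfl | hu
    · exact ⟨u, Finset.mem_insert_self _ _, le_rfl, Or.inl rfl⟩
    · obtain ⟨w, hw, hdw, huw⟩ := hF.root u hu
      by_cases hwZ : w ∈ Z
      · refine ⟨v, Finset.mem_insert_self _ _, ?_, Or.inr fun x hx => ?_⟩
        · rw [hd u hu, hdv]
          have := Finset.le_sup (f := fun w => d w + 1) hwZ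
          omega
        · rw [key u hu w (hF.sub hw) huw x hx]
          exact hZE w hwZ x hx
      · refine ⟨w, Finset.mem_insert_of_mem (Finset.mem_sdiff.2 ⟨hw, hwZ⟩), ?_,
          huw.imp_right fun h x hx => h x (hBA hx)⟩
        rw [hd u hu, hd w (hF.sub hw)]
        exact hdw
  · intro i
    by_cases hi : (Z.sup fun w => d w + 1) = i
    · have : ((insert v S).filter fun u =>
          Function.update d v (Z.sup fun w => d w + 1) u = i) =
          insert v (S.filter fun u => d u = i) := by
        ext u
        simp only [Finset.mem_filter, Finset.mem_insert]
        constructor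
        · rintro ⟨rfl | hu, h⟩
          · exact Or.inl rfl
          · exact Or.inr ⟨hu, by rwa [hd u hu] at h⟩
        · rintro (rfl | ⟨hu, h⟩)
          · exact ⟨Or.inl rfl, by rw [hdv, hi]⟩
          · exact ⟨Or.inr hu, by rwa [hd u hu]⟩
      rw [this]
      apply HoldsWith.insert hs (hF.level i) hv hBA
      intro u hu x hx
      rw [Finset.mem_filter] at hu
      obtain ⟨w, hw, hdw, huw⟩ := hF.root u hu.1
      rw [key u hu.1 w (hF.sub hw) huw x hx]
      apply hRE w (Finset.mem_sdiff.2 ⟨hw, fun hwZ => ?_⟩) x hx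
      have := Finset.le_sup (f := fun w => d w + 1) hwZ
      omega
    · have : ((insert v S).filter fun u =>
          Function.update d v (Z.sup fun w => d w + 1) u = i) =
          (S.filter fun u => d u = i) := by
        ext u
        simp only [Finset.mem_filter, Finset.mem_insert]
        constructor
        · rintro ⟨rfl | hu, h⟩
          · rw [hdv] at h; exact absurd h hi
          · exact ⟨hu, by rwa [hd u hu] at h⟩
        · rintro ⟨hu, h⟩
          exact ⟨Or.inr hu, by rwa [hd u hu]⟩
      rw [this]
      exact (hF.level i).mono hBA
  · intro w hw
    rcases Finset.mem_insert.1 hw with rfl | hw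
    · rw [hdv]
      rcases Z.eq_empty_or_nonempty with rfl | hne
      · refine ⟨{w}, by simp, by simp, by simp, ?_, ?_⟩
        · intro x hx y hy z _ hxy
          rw [Finset.mem_singleton] at hx hy
          exact absurd (hx.trans hy.symm) hxy
        · intro x hx y hy hxy
          rw [Finset.mem_singleton] at hx hy
          exact absurd (hx.trans hy.symm) hxy
      · obtain ⟨r, hr, hsup⟩ := Finset.exists_mem_eq_sup Z hne fun w => d w + 1
        obtain ⟨C, hC, hrC, hcard, hHW⟩ := hF.chain r (hZ hr)
        refine ⟨insert w C, Finset.insert_subset_insert _ hC, Finset.mem_insert_self _ _, ?_, ?_⟩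
        · rw [hsup, Finset.card_insert_of_notMem fun h => hvS (hC h)]
          omega
        · apply HoldsWith.insert hs.compl hHW hv hBA
          intro u hu x hx
          by_cases hur : u = r
          · rw [hur]; exact hZE r hr x hx
          · have := key u (hC hu) r (hC hrC) (Or.inr (hHW.2 u hu r hrC hur)) x hx
            unfold Compl3
            rw [this]
            exact hZE r hr x hx
    · rw [Finset.mem_sdiff] at hw
      obtain ⟨C, hC, hwC, hcard, hHW⟩ := hF.chain w hw.1
      refine ⟨C, hC.trans (Finset.subset_insert _ _), hwC, ?_, hHW.mono hBA⟩
      rwa [hd w (hF.sub hw.1)]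

theorem Nat.succ_pow_le_three_mul_pow {s k : ℕ} (hs : 0 < s) (hk : k ≤ s) :
    (s + 1) ^ k ≤ 3 * s ^ k := by
  have hs' : (0 : ℝ) < s := by exact_mod_cast hs
  have h1 : ((s : ℝ) + 1) ^ k ≤ 3 * (s : ℝ) ^ k := by
    have h2 : (s : ℝ) + 1 ≤ s * Real.exp (1 / s) := by
      have := Real.add_one_le_exp (1 / (s : ℝ))
      calc (s : ℝ) + 1 = s * (1 / s + 1) := by field_simp; ring
        _ ≤ _ := by gcongr
    calc ((s : ℝ) + 1) ^ k ≤ (s * Real.exp (1 / s)) ^ k := by gcongr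
      _ = Real.exp (k * (1 / s)) * s ^ k := by rw [mul_pow, ← Real.exp_nat_mul, mul_comm]
      _ ≤ Real.exp 1 * s ^ k := by
        gcongr
        rw [mul_one_div, div_le_one hs']
        exact_mod_cast hk
      _ ≤ 3 * (s : ℝ) ^ k := by
        gcongr
        exact Real.exp_one_lt_three.le
  exact_mod_cast h1

/-- The potential |A| / (s+1)^|R| drops by a factor at most 6(s+1) per pick: the loss (s+1)^|Z| is
offset by the |Z| roots that disappear, the new root costs s + 1, the kept roots cost (1+1/s)^s < 3,
and deleting v from A costs at most 2. -/
theorem exists_tripleForest [Fintype V] {E : V → V → V → Prop} (hs : Symm3 E) (h1 : NoOne E)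
    {s : ℕ} (hs0 : 0 < s) (hom : ∀ S : Finset V, HoldsOn E S → S.card ≤ s)
    (hN : (6 * (s + 1)) ^ (s ^ 2) < Fintype.card V) (m : ℕ) (hm : m ≤ s ^ 2 + 1) :
    ∃ S A R d, TripleForest E S A R d ∧ S.card = m ∧
      Fintype.card V * (s + 1) ^ R.card ≤ A.card * (6 * (s + 1)) ^ m := by
  induction m with
  | zero =>
    refine ⟨∅, Finset.univ, ∅, fun _ => 0, ?_, rfl, by simp⟩
    constructor <;> simp [HoldsWith, HoldsOn]
  | succ m ih =>
    obtain ⟨S, A, R, d, hF, hSm, hc⟩ := ih (by omega)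
    have hA : 1 < A.card := by
      by_contra hA
      have h2 : A.card * (6 * (s + 1)) ^ m ≤ 1 * (6 * (s + 1)) ^ (s ^ 2) :=
        Nat.mul_le_mul (by omega) (Nat.pow_le_pow_right (by omega) (by omega))
      have h3 : Fintype.card V * 1 ≤ Fintype.card V * (s + 1) ^ R.card :=
        Nat.mul_le_mul_left _ (Nat.one_le_pow' _ _)
      omega
    obtain ⟨v, hv⟩ := Finset.card_pos.1 (show 0 < A.card by omega)
    obtain ⟨Z, hZ, B, hB, h0, h1', hcard⟩ := exists_split (fun w x => E w v x) s R (A.erase v)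
    have hvS : v ∉ S := fun h => Finset.disjoint_left.1 hF.disj h hv
    refine ⟨_, _, _, _, hF.step hs h1 hv hB hZ h0 h1', ?_, ?_⟩
    · rw [Finset.card_insert_of_notMem hvS, hSm]
    · have hRs : R.card ≤ s := hom R hF.roots.1
      rw [Finset.card_insert_of_notMem fun h => hvS (hF.sub (Finset.mem_sdiff.1 h).1)]
      have hRZ : (R \ Z).card + Z.card = R.card := Finset.card_sdiff_add_card_eq_card hZ
      have h3 := Nat.succ_pow_le_three_mul_pow hs0 (show (R \ Z).card ≤ s by omega)
      have h4 : A.card ≤ 6 * B.card * (s + 1) ^ Z.card := by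
        have h5 : (A.erase v).card ≤ 3 * (B.card * (s + 1) ^ Z.card) := by
          have hpos : 0 < s ^ (R \ Z).card := by positivity
          refine Nat.le_of_mul_le_mul_right (hcard.trans ?_) hpos
          rw [← hRZ, pow_add]
          calc B.card * ((s + 1) ^ (R \ Z).card * (s + 1) ^ Z.card)
              = (B.card * (s + 1) ^ Z.card) * (s + 1) ^ (R \ Z).card := by ring
            _ ≤ (B.card * (s + 1) ^ Z.card) * (3 * s ^ (R \ Z).card) := Nat.mul_le_mul_left _ h3
            _ = _ := by ring
        rw [Finset.card_erase_of_mem hv] at h5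
        have h6 : 6 * B.card * (s + 1) ^ Z.card = 2 * (3 * (B.card * (s + 1) ^ Z.card)) := by ring
        omega
      have hpos : 0 < (s + 1) ^ Z.card := by positivity
      refine Nat.le_of_mul_le_mul_right ?_ hpos
      calc Fintype.card V * (s + 1) ^ ((R \ Z).card + 1) * (s + 1) ^ Z.card
          = Fintype.card V * (s + 1) ^ R.card * (s + 1) := by rw [← hRZ]; ring
        _ ≤ A.card * (6 * (s + 1)) ^ m * (s + 1) := Nat.mul_le_mul_right _ hc
        _ ≤ (6 * B.card * (s + 1) ^ Z.card) * (6 * (s + 1)) ^ m * (s + 1) := by gcongr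
        _ = _ := by ring

/-- Heights are below s because a chain is a coclique. Thus s^2 + 1 picked vertices put more than s
on one level, which is a clique. -/
theorem NoOne.card_le [Fintype V] {E : V → V → V → Prop} (hs : Symm3 E) (h1 : NoOne E)
    {s : ℕ} (hs0 : 0 < s)
    (hom : ∀ S : Finset V, HoldsOn E S ∨ HoldsOn (Compl3 E) S → S.card ≤ s) :
    Fintype.card V ≤ (6 * (s + 1)) ^ (s ^ 2) := by
  by_contra hN
  push Not at hN
  obtain ⟨S, A, R, d, hF, hSm, -⟩ :=
    exists_tripleForest hs h1 hs0 (fun S hS => hom S (Or.inl hS)) hN (s ^ 2 + 1) le_rfl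
  have hmaps : ∀ u ∈ S, d u ∈ Finset.range s := by
    intro u hu
    obtain ⟨w, hw, hdw, -⟩ := hF.root u hu
    obtain ⟨C, -, -, hc, hHW⟩ := hF.chain w hw
    have := hom C (Or.inr hHW.1)
    rw [Finset.mem_range]
    omega
  obtain ⟨i, -, hi⟩ := Finset.exists_lt_card_fiber_of_mul_lt_card_of_maps_to (n := s) hmaps (by
    rw [Finset.card_range, hSm]; nlinarith)
  exact absurd (hom _ (Or.inl (hF.level i).1)) (by omega)

end NoOne

/-- With l = log n, the hypothesis gives l ≤ 5 h² log h. If h² ≤ l / (25 log l), then h² ≤ l, so log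
h ≤ (log l)/2 and l ≤ l/10, which is absurd. -/
theorem exists_pos_mul_sqrt_log_div_lt :
    ∃ c : ℝ, 0 < c ∧ ∀ (n h : ℕ), 3 ≤ n → 2 ≤ h → n ≤ (6 * (h + 1)) ^ (h ^ 2) →
      c * (Real.log (n : ℝ) / Real.log (Real.log (n : ℝ))) ^ (1 / 2 : ℝ) < h := by
  refine ⟨1 / 5, by norm_num, ?_⟩
  intro n h hn hh hle
  have hn' : (3 : ℝ) ≤ n := by exact_mod_cast hn
  have hh' : (2 : ℝ) ≤ h := by exact_mod_cast hh
  -- At n = 3 the double logarithm is only slightly positive; a definite lower bound on it is needed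
  -- to deduce h² ≤ l.
  have hlog3 : (1.09 : ℝ) < Real.log 3 := by
    have h1 := Real.one_sub_inv_le_log_of_pos (x := 3 / Real.exp 1) (by positivity)
    rw [Real.log_div (by norm_num) (by positivity), Real.log_exp, inv_div] at h1
    have := Real.exp_one_lt_d9
    linarith
  set l := Real.log (n : ℝ) with hl
  have hl1 : 1.09 < l := hlog3.trans_le (Real.log_le_log (by norm_num) hn')
  have hll : 0.08 < Real.log l := by
    have h1 := Real.one_sub_inv_le_log_of_pos (x := l) (by linarith)
    have h2 : l⁻¹ ≤ 1.09⁻¹ := inv_anti₀ (by norm_num) hl1.le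
    have h3 : (1.09 : ℝ)⁻¹ < 0.92 := by norm_num
    linarith
  have hlogn : l ≤ 5 * h ^ 2 * Real.log h := by
    have h1 : n ≤ h ^ (5 * h ^ 2) := by
      refine hle.trans ?_
      rw [pow_mul]
      refine Nat.pow_le_pow_left ?_ _
      have : 2 ^ 4 ≤ h ^ 4 := Nat.pow_le_pow_left hh 4
      calc 6 * (h + 1) ≤ 2 ^ 4 * h := by omega
        _ ≤ h ^ 4 * h := Nat.mul_le_mul_right _ this
        _ = h ^ 5 := by ring
    have h2 : (n : ℝ) ≤ (h : ℝ) ^ (5 * h ^ 2) := by exact_mod_cast h1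
    have h3 := Real.log_le_log (by linarith) h2
    rw [Real.log_pow] at h3
    push_cast at h3
    exact h3
  rw [← Real.sqrt_eq_rpow]
  by_contra hcon
  push Not at hcon
  have hsq : (h : ℝ) ^ 2 ≤ 1 / 25 * (l / Real.log l) := by
    have h1 : (h : ℝ) ^ 2 ≤ (1 / 5 * √(l / Real.log l)) ^ 2 := by gcongr
    rw [mul_pow, Real.sq_sqrt (div_nonneg (by linarith) (by linarith))] at h1
    linarith
  have hsq2 : (h : ℝ) ^ 2 * Real.log l ≤ 1 / 25 * l := by
    rw [← mul_div_assoc, le_div_iff₀ (by linarith)] at hsq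
    exact hsq
  have hhl : (h : ℝ) ^ 2 ≤ l := by nlinarith [sq_nonneg (h : ℝ)]
  have hlogh : 2 * Real.log h ≤ Real.log l := by
    have := Real.log_le_log (by positivity) hhl
    rw [Real.log_pow] at this
    exact_mod_cast this
  nlinarith [sq_nonneg (h : ℝ)]

theorem exists_lt_minHomNumber_four_one :
    ∃ c : ℝ, 0 < c ∧ ∀ n : ℕ, 3 ≤ n →
      c * (Real.log (n : ℝ) / Real.log (Real.log (n : ℝ))) ^ (1 / 2 : ℝ) <
        (minHomNumber 3 n {(4, 1)} : ℝ) := by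
  obtain ⟨c, hc, h⟩ := exists_pos_mul_sqrt_log_div_lt
  refine ⟨c, hc, fun n hn => ?_⟩
  obtain ⟨H, hfree, hH⟩ := exists_homNumber_eq_minHomNumber n 4 1 one_ne_zero
  have h2 : 2 ≤ H.homNumber := H.two_le_homNumber (by rw [Fintype.card_fin]; omega)
  have h3 := NoOne.card_le H.symm3_adj3 (RGraph.noOne_adj3 hfree) (by omega)
    fun S hS => H.card_le_homNumber hS
  rw [Fintype.card_fin] at h3
  rw [← hH]
  exact h n _ hn h2 h3

/-! ### Union bound for uniformly chosen m-sets. -/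

section Sampling

/-- A fixed k-set lies in a random m-set with probability at most (m/N)^k. -/
theorem Nat.choose_sub_mul_pow_le {N m k : ℕ} (hk : k ≤ m) (hm : m ≤ N) :
    (N - k).choose (m - k) * N ^ k ≤ N.choose m * m ^ k := by
  induction k with
  | zero => simp
  | succ k ih =>
    have ih := ih (by omega)
    obtain ⟨a, rfl⟩ : ∃ a, m = k + 1 + a := ⟨m - (k + 1), by omega⟩
    obtain ⟨b, rfl⟩ : ∃ b, N = k + 1 + b := ⟨N - (k + 1), by omega⟩
    rw [show k + 1 + b - (k + 1) = b by omega, show k + 1 + a - (k + 1) = a by omega]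
    rw [show k + 1 + b - k = b + 1 by omega, show k + 1 + a - k = a + 1 by omega] at ih
    have h1 := Nat.add_one_mul_choose_eq b a
    refine Nat.le_of_mul_le_mul_left ?_ (show 0 < b + 1 by omega)
    calc (b + 1) * (b.choose a * (k + 1 + b) ^ (k + 1))
        = ((b + 1) * b.choose a) * (k + 1 + b) ^ (k + 1) := by ring
      _ = ((b + 1).choose (a + 1) * (k + 1 + b) ^ k) * ((a + 1) * (k + 1 + b)) := by rw [h1]; ring
      _ ≤ ((k + 1 + b).choose (k + 1 + a) * (k + 1 + a) ^ k) * ((k + 1 + a) * (b + 1)) := by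
        refine Nat.mul_le_mul ih ?_
        nlinarith
      _ = _ := by ring

variable {V : Type*} [Fintype V] [DecidableEq V]

theorem Finset.card_filter_subset_powersetCard_le {B : Finset V} {m : ℕ} :
    ((Finset.powersetCard m Finset.univ).filter fun W => B ⊆ W).card ≤
      (Fintype.card V - B.card).choose (m - B.card) := by
  rw [← Finset.card_compl, ← Finset.card_powersetCard]
  apply Finset.card_le_card_of_injOn (fun W => W \ B)
  · intro W hW
    simp only [Finset.coe_filter, Finset.mem_powersetCard, Set.mem_ofPred_eq] at hW
    rw [Finset.mem_coe, Finset.mem_powersetCard, Finset.card_sdiff_of_subset hW.2, hW.1.2]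
    refine ⟨fun x hx => ?_, rfl⟩
    rw [Finset.mem_compl]
    exact (Finset.mem_sdiff.1 hx).2
  · intro W hW W' hW' h
    simp only [Finset.coe_filter, Finset.mem_powersetCard, Set.mem_ofPred_eq] at hW hW'
    simp only at h
    rw [← Finset.sdiff_union_of_subset hW.2, h, Finset.sdiff_union_of_subset hW'.2]

/-- If few `k`-sets are forbidden, then some `m`-set contains none of them. -/
theorem exists_card_eq_forall_not_subset (F : Finset (Finset V)) {k m : ℕ}
    (hk : ∀ B ∈ F, B.card = k) (hm : m ≤ Fintype.card V)
    (hF : F.card * m ^ k < Fintype.card V ^ k) :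
    ∃ W : Finset V, W.card = m ∧ ∀ B ∈ F, ¬ B ⊆ W := by
  by_cases hkm : k ≤ m
  · by_contra! hcon
    have hcover : Finset.powersetCard m (Finset.univ : Finset V) ⊆
        F.biUnion fun B => (Finset.powersetCard m Finset.univ).filter fun W => B ⊆ W := by
      intro W hW
      obtain ⟨B, hB, hBW⟩ := hcon W (Finset.mem_powersetCard.1 hW).2
      exact Finset.mem_biUnion.2 ⟨B, hB, Finset.mem_filter.2 ⟨hW, hBW⟩⟩
    have h1 := (Finset.card_le_card hcover).trans (Finset.card_biUnion_le_card_mul _ _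
      ((Fintype.card V - k).choose (m - k)) fun B hB => by
        have := Finset.card_filter_subset_powersetCard_le (B := B) (m := m)
        rwa [hk B hB] at this)
    rw [Finset.card_powersetCard, Finset.card_univ] at h1
    have hpos : 0 < (Fintype.card V).choose m := Nat.choose_pos hm
    have h2 := Nat.choose_sub_mul_pow_le hkm hm
    have h3 : (Fintype.card V).choose m * Fintype.card V ^ k ≤
        (Fintype.card V).choose m * (F.card * m ^ k) :=
      calc _ ≤ F.card * (Fintype.card V - k).choose (m - k) * Fintype.card V ^ k :=
            Nat.mul_le_mul_right _ h1
        _ = F.card * ((Fintype.card V - k).choose (m - k) * Fintype.card V ^ k) := by ring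
        _ ≤ F.card * ((Fintype.card V).choose m * m ^ k) := Nat.mul_le_mul_left _ h2
        _ = _ := by ring
    have := Nat.le_of_mul_le_mul_left h3 hpos
    omega
  · obtain ⟨W, -, hW⟩ := Finset.exists_subset_card_eq (s := (Finset.univ : Finset V)) (n := m) hm
    refine ⟨W, hW, fun B hB h => ?_⟩
    have := Finset.card_le_card h
    rw [hk B hB] at this
    omega

end Sampling

/-! ### (4,2)-free graphs: sampling and decomposition. -/

section NoTwo

variable {V : Type*}

/-- Two triples of `E` meeting exactly in `x`, with no other triple of `E` through `x`. -/
structure Bowtie (E : V → V → V → Prop) (x a b c d : V) : Prop where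
  nodup : [x, a, b, c, d].Nodup
  left : E x a b
  right : E x c d
  ac : ¬ E x a c
  ad : ¬ E x a d
  bc : ¬ E x b c
  bd : ¬ E x b d

/-- For distinct centers x and y, the edges xab, yab force pxy for some p in {a, b}, and likewise
qxy for some q in {c, d}. These two edges force xpq or ypq, contrary to both bowties. -/
theorem Bowtie.center_unique {E : V → V → V → Prop} (hs : Symm3 E) (h2 : NoTwo E)
    {x y a b c d : V} (hx : Bowtie E x a b c d) (hy : Bowtie E y a b c d) : x = y := by
  by_contra hxy
  have s1 := hs.swap12
  have s2 := hs.swap23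
  obtain ⟨hxn, hx1, hx2, hx3, hx4, hx5, hx6⟩ := hx
  obtain ⟨hyn, hy1, hy2, hy3, hy4, hy5, hy6⟩ := hy
  simp only [List.nodup_cons, List.mem_cons, List.not_mem_nil, or_false, not_or, not_false_eq_true,
    List.nodup_nil, and_true] at hxn hyn
  have key : ∀ p q, x ≠ p → x ≠ q → y ≠ p → y ≠ q → p ≠ q → ¬ E x p q → ¬ E y p q →
      E p x y → ¬ E q x y := by
    intro p q h3 h4 h5 h6 h7 h8 h9 h10 h11
    rcases h2 x y p q hxy h3 h4 h5 h6 h7 (hs.rot h10) (hs.rot h11) with h | h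
    · exact h8 h
    · exact h9 h
  have e1 := h2 a b x y (by grind) (by grind) (by grind) (by grind) (by grind) hxy
    (hs.rot hx1) (hs.rot hy1)
  have e2 := h2 c d x y (by grind) (by grind) (by grind) (by grind) (by grind) hxy
    (hs.rot hx2) (hs.rot hy2)
  rcases e1 with e1 | e1 <;> rcases e2 with e2 | e2
  · exact key a c (by grind) (by grind) (by grind) (by grind) (by grind) hx3 hy3 e1 e2
  · exact key a d (by grind) (by grind) (by grind) (by grind) (by grind) hx4 hy4 e1 e2
  · exact key b c (by grind) (by grind) (by grind) (by grind) (by grind) hx5 hy5 e1 e2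
  · exact key b d (by grind) (by grind) (by grind) (by grind) (by grind) hx6 hy6 e1 e2

/-- The center is a function of (a, b, c, d), which saves the factor N that makes sampling possible.
-/
theorem exists_bowtie_cover [Fintype V] [DecidableEq V] {E : V → V → V → Prop} (hs : Symm3 E) (h2 : NoTwo E) :
    ∃ F : Finset (Finset V), (∀ B ∈ F, B.card = 5) ∧ F.card ≤ Fintype.card V ^ 4 ∧
      ∀ x a b c d, Bowtie E x a b c d → {x, a, b, c, d} ∈ F := by
  classical
  let T : Finset (V × V × V × V × V) :=
    Finset.univ.filter fun p => Bowtie E p.1 p.2.1 p.2.2.1 p.2.2.2.1 p.2.2.2.2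
  refine ⟨T.image fun p => {p.1, p.2.1, p.2.2.1, p.2.2.2.1, p.2.2.2.2}, ?_, ?_, ?_⟩
  · intro B hB
    obtain ⟨p, hp, rfl⟩ := Finset.mem_image.1 hB
    have hn := (Finset.mem_filter.1 hp).2.nodup
    have := List.toFinset_card_of_nodup hn
    simpa using this
  · refine Finset.card_image_le.trans ?_
    have h1 : T.card ≤ (Finset.univ : Finset (V × V × V × V)).card := by
      apply Finset.card_le_card_of_injOn (fun p => p.2) (fun _ _ => Finset.mem_univ _)
      rintro ⟨x, p⟩ hp ⟨y, q⟩ hq h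
      simp only at h
      subst h
      have := Bowtie.center_unique hs h2 (Finset.mem_filter.1 hp).2 (Finset.mem_filter.1 hq).2
      simp only at this
      rw [this]
    refine h1.trans (le_of_eq ?_)
    simp only [Finset.card_univ, Fintype.card_prod]
    ring
  · intro x a b c d h
    exact Finset.mem_image.2 ⟨(x, a, b, c, d), Finset.mem_filter.2 ⟨Finset.mem_univ _, h⟩, rfl⟩

theorem exists_bowtie_free [Fintype V] [DecidableEq V] {E : V → V → V → Prop} (hs : Symm3 E)
    (h2 : NoTwo E) {m : ℕ} (hm : 2 * m ^ 5 < Fintype.card V) :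
    ∃ W : Finset V, W.card = m ∧
      ∀ x ∈ W, ∀ a ∈ W, ∀ b ∈ W, ∀ c ∈ W, ∀ d ∈ W,
        ¬ Bowtie E x a b c d ∧ ¬ Bowtie (Compl3 E) x a b c d := by
  obtain ⟨F, hF5, hFc, hF⟩ := exists_bowtie_cover hs h2
  obtain ⟨G, hG5, hGc, hG⟩ := exists_bowtie_cover hs.compl (h2.compl hs)
  have hmN : m ≤ Fintype.card V := by
    have : m ≤ m ^ 5 := Nat.le_self_pow (by norm_num) m
    omega
  obtain ⟨W, hW, hno⟩ := exists_card_eq_forall_not_subset (F ∪ G) (k := 5) (m := m) (by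
    intro B hB
    rcases Finset.mem_union.1 hB with h | h
    · exact hF5 B h
    · exact hG5 B h) hmN (by
    have h3 : (F ∪ G).card ≤ 2 * Fintype.card V ^ 4 := by
      have := Finset.card_union_le F G
      omega
    have hpos : 0 < Fintype.card V ^ 4 := by
      have : 0 < Fintype.card V := by omega
      positivity
    calc (F ∪ G).card * m ^ 5 ≤ 2 * Fintype.card V ^ 4 * m ^ 5 := Nat.mul_le_mul_right _ h3
      _ = Fintype.card V ^ 4 * (2 * m ^ 5) := by ring
      _ < Fintype.card V ^ 4 * Fintype.card V := Nat.mul_lt_mul_of_pos_left hm hpos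
      _ = _ := by ring)
  refine ⟨W, hW, fun x hx a ha b hb c hc d hd => ?_⟩
  have hsub : ({x, a, b, c, d} : Finset V) ⊆ W := by
    simp only [Finset.insert_subset_iff, Finset.singleton_subset_iff]
    exact ⟨hx, ha, hb, hc, hd⟩
  exact ⟨fun h => hno _ (Finset.mem_union_left _ (hF x a b c d h)) hsub,
    fun h => hno _ (Finset.mem_union_right _ (hG x a b c d h)) hsub⟩

/-- A graph without isolated vertices and without induced `P₄`, `C₄`, `2K₂` has a dominating
vertex. -/
theorem exists_dominating {L : V → V → Prop} (hsymm : ∀ ⦃a b⦄, L a b → L b a)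
    (hirr : ∀ a, ¬ L a a) {Q : Finset V} (hQ : Q.Nonempty) (hdeg : ∀ w ∈ Q, ∃ z ∈ Q, L w z)
    (hP : ∀ a ∈ Q, ∀ b ∈ Q, ∀ c ∈ Q, ∀ d ∈ Q, L a b → L b c → L c d → ¬ L a c → ¬ L b d →
      a ≠ c → b ≠ d → a ≠ d → False)
    (hK : ∀ a ∈ Q, ∀ b ∈ Q, ∀ c ∈ Q, ∀ d ∈ Q, L a b → L c d → ¬ L a c → ¬ L a d → ¬ L b c →
      ¬ L b d → a ≠ c → a ≠ d → b ≠ c → b ≠ d → False) :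
    ∃ u ∈ Q, ∀ q ∈ Q, q ≠ u → L u q := by
  classical
  obtain ⟨u, hu, hmax⟩ := Finset.exists_max_image Q (fun w => (Q.filter (L w)).card) hQ
  -- Otherwise w is a neighbour of z but not of u; by maximality of the degree of u some y is a
  -- neighbour of u but not of z, and y, u, z, w form an induced P₄ or C₄. So u dominates its
  -- component, and 2K₂-freeness excludes further components.
  have htrans : ∀ z ∈ Q, ∀ w ∈ Q, L u z → L z w → w ≠ u → L u w := by
    intro z hz w hw huz hzw hwu
    by_contra huw
    have hcard : ((Q.filter (L z)).erase u).card ≤ ((Q.filter (L u)).erase z).card := by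
      rw [Finset.card_erase_of_mem (Finset.mem_filter.2 ⟨hu, hsymm huz⟩),
        Finset.card_erase_of_mem (Finset.mem_filter.2 ⟨hz, huz⟩)]
      have := hmax z hz
      omega
    have hw1 : w ∈ (Q.filter (L z)).erase u :=
      Finset.mem_erase.2 ⟨hwu, Finset.mem_filter.2 ⟨hw, hzw⟩⟩
    have hw2 : w ∉ (Q.filter (L u)).erase z := fun h =>
      huw (Finset.mem_filter.1 (Finset.mem_erase.1 h).2).2
    obtain ⟨y, hy, hy'⟩ : ∃ y ∈ (Q.filter (L u)).erase z, y ∉ (Q.filter (L z)).erase u := by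
      by_contra! hsub
      have := Finset.eq_of_subset_of_card_le hsub hcard
      exact hw2 (this ▸ hw1)
    simp only [Finset.mem_erase, Finset.mem_filter, not_and] at hy hy'
    obtain ⟨hyz, hyQ, huy⟩ := hy
    have hyu : y ≠ u := fun h => hirr u (h ▸ huy)
    refine hP y hyQ u hu z hz w hw (hsymm huy) huz hzw (fun h => hy' hyu hyQ (hsymm h)) huw hyz
      hwu.symm ?_
    rintro rfl
    exact huw huy
  refine ⟨u, hu, fun w hw hwu => ?_⟩
  by_contra huw
  obtain ⟨z, hz, hwz⟩ := hdeg w hw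
  obtain ⟨y, hy, huy⟩ := hdeg u hu
  have hzu : z ≠ u := fun h => huw (hsymm (h ▸ hwz))
  have huz : ¬ L u z := fun h => huw (htrans z hz w hw h (hsymm hwz) hwu)
  refine hK u hu y hy w hw z hz huy hwz huw huz (fun h => huw (htrans y hy w hw huy h hwu))
    (fun h => huz (htrans y hy z hz huy h hzu)) hwu.symm hzu.symm ?_ ?_
  · rintro rfl; exact huw huy
  · rintro rfl; exact huz huy

/-- The path forces edges abc and bcd, hence abd or acd. Together with vab or vcd, such an edge
forces one of the triples that the induced path excludes. -/
theorem NoTwo.link_no_path {E : V → V → V → Prop} (hs : Symm3 E) (h2 : NoTwo E) {v a b c d : V}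
    (hn : [v, a, b, c, d].Nodup) (hab : E v a b) (hbc : E v b c) (hcd : E v c d)
    (hac : ¬ E v a c) (hbd : ¬ E v b d) (had : ¬ E v a d) : False := by
  have s1 := hs.swap12
  have s2 := hs.swap23
  simp only [List.nodup_cons, List.mem_cons, List.not_mem_nil, or_false, not_or, not_false_eq_true,
    List.nodup_nil, and_true] at hn
  have e1 : E a b c := by
    rcases h2 v b a c (by grind) (by grind) (by grind) (by grind) (by grind) (by grind)
      (s2 hab) hbc with h | h
    · exact absurd h hac
    · exact s1 h
  have e2 : E b c d := by
    rcases h2 v c b d (by grind) (by grind) (by grind) (by grind) (by grind) (by grind)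
      (s2 hbc) hcd with h | h
    · exact absurd h hbd
    · exact s1 h
  have e3 : ¬ E a b d := by
    intro h
    rcases h2 a b v d (by grind) (by grind) (by grind) (by grind) (by grind) (by grind)
      (hs.rot hab) h with h | h
    · exact had (s1 h)
    · exact hbd (s1 h)
  have e4 : ¬ E c d a := by
    intro h
    rcases h2 c d v a (by grind) (by grind) (by grind) (by grind) (by grind) (by grind)
      (hs.rot hcd) h with h | h
    · exact hac (hs.swap23 (s1 h))
    · exact had (hs.swap23 (s1 h))
  rcases h2 b c a d (by grind) (by grind) (by grind) (by grind) (by grind) (by grind)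
      (hs.rot e1) e2 with h | h
  · exact e3 (s1 h)
  · exact e4 (s2 h)

/-- `E` holds on all triples meeting both `A` and `B` (for disjoint `A`, `B`). -/
def HoldsAcross (E : V → V → V → Prop) (A B : Finset V) : Prop :=
  (∀ a ∈ A, ∀ b ∈ B, ∀ c ∈ B, b ≠ c → E a b c) ∧ ∀ a ∈ A, ∀ b ∈ A, ∀ c ∈ B, a ≠ b → E a b c

/-- No bowtie of `E` or of its complement lies in `W`. -/
def BowtieFreeOn (E : V → V → V → Prop) (W : Finset V) : Prop :=
  ∀ x ∈ W, ∀ a ∈ W, ∀ b ∈ W, ∀ c ∈ W, ∀ d ∈ W,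
    ¬ Bowtie E x a b c d ∧ ¬ Bowtie (Compl3 E) x a b c d

theorem BowtieFreeOn.compl {E : V → V → V → Prop} {W : Finset V} (h : BowtieFreeOn E W) :
    BowtieFreeOn (Compl3 E) W := by
  intro x hx a ha b hb c hc d hd
  rw [Symm3.compl_compl]
  exact (h x hx a ha b hb c hc d hd).symm

theorem BowtieFreeOn.mono {E : V → V → V → Prop} {W U : Finset V} (h : BowtieFreeOn E W)
    (hU : U ⊆ W) : BowtieFreeOn E U :=
  fun x hx a ha b hb c hc d hd => h x (hU hx) a (hU ha) b (hU hb) c (hU hc) d (hU hd)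

theorem exists_link_dominating {E : V → V → V → Prop} (hs : Symm3 E) (h2 : NoTwo E)
    {W Q : Finset V} (hW : BowtieFreeOn E W) {v : V} (hv : v ∈ W) (hQW : Q ⊆ W) (hvQ : v ∉ Q)
    (hQ : Q.Nonempty) (hdeg : ∀ w ∈ Q, ∃ z ∈ Q, z ≠ w ∧ E v w z) :
    ∃ u ∈ Q, ∀ q ∈ Q, q ≠ u → E v u q := by
  have hvne : ∀ {x}, x ∈ Q → v ≠ x := fun hx h => hvQ (h ▸ hx)
  obtain ⟨u, hu, hdom⟩ := exists_dominating (L := fun a b => a ≠ b ∧ E v a b)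
    (fun a b h => ⟨h.1.symm, hs.swap23 h.2⟩) (fun a h => h.1 rfl) hQ
    (fun w hw => by
      obtain ⟨z, hz, hzw, he⟩ := hdeg w hw
      exact ⟨z, hz, hzw.symm, he⟩)
    (by
      intro a ha b hb c hc d hd hab hbc hcd hac hbd hac' hbd' had'
      have hac := fun h => hac ⟨hac', h⟩
      have hbd := fun h => hbd ⟨hbd', h⟩
      by_cases had : E v a d
      · refine (hW v hv a (hQW ha) c (hQW hc) b (hQW hb) d (hQW hd)).2
          ⟨?_, hac, hbd, fun h => h hab.2, fun h => h had, fun h => h (hs.swap23 hbc.2),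
          fun h => h hcd.2⟩
        simp [hvne ha, hvne hb, hvne hc, hvne hd, hac', hbd', had', hab.1, hbc.1.symm, hcd.1]
      · refine h2.link_no_path hs ?_ hab.2 hbc.2 hcd.2 hac hbd had
        simp [hvne ha, hvne hb, hvne hc, hvne hd, hac', hbd', had', hab.1, hbc.1, hcd.1])
    (by
      intro a ha b hb c hc d hd hab hcd hac had hbc hbd hac' had' hbc' hbd'
      refine (hW v hv a (hQW ha) b (hQW hb) c (hQW hc) d (hQW hd)).1
          ⟨?_, hab.2, hcd.2, fun h => hac ⟨hac', h⟩, fun h => had ⟨had', h⟩,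
          fun h => hbc ⟨hbc', h⟩, fun h => hbd ⟨hbd', h⟩⟩
      simp [hvne ha, hvne hb, hvne hc, hvne hd, hac', hbd', had', hab.1, hbc', hcd.1])
  exact ⟨u, hu, fun q hq hqu => (hdom q hq hqu).2⟩

variable [DecidableEq V]

/-- The set I of all isolated vertices of the link of v in W is separated from W \ I. If the link is
empty, v alone is separated instead. -/
theorem exists_holdsAcross_of_isolated {E : V → V → V → Prop} (hs : Symm3 E) (h2 : NoTwo E)
    {W : Finset V} (hW : BowtieFreeOn E W) {v i₀ : V} (hv : v ∈ W) (hi₀ : i₀ ∈ W) (hne : i₀ ≠ v)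
    (hiso : ∀ z ∈ W, z ≠ v → z ≠ i₀ → ¬ E v i₀ z) :
    ∃ A B : Finset V, A ∪ B = W ∧ Disjoint A B ∧ A.Nonempty ∧ B.Nonempty ∧
      HoldsAcross (Compl3 E) A B := by
  classical
  have s1 := hs.swap12
  have s2 := hs.swap23
  let I := W.filter fun i => i ≠ v ∧ ∀ z ∈ W, z ≠ v → z ≠ i → ¬ E v i z
  have hIW : I ⊆ W := Finset.filter_subset _ _
  have hI : ∀ i ∈ I, i ∈ W ∧ i ≠ v ∧ ∀ z ∈ W, z ≠ v → z ≠ i → ¬ E v i z := fun i hi =>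
    Finset.mem_filter.1 hi
  have hi₀I : i₀ ∈ I := Finset.mem_filter.2 ⟨hi₀, hne, hiso⟩
  have hvI : v ∉ I := fun h => (hI v h).2.1 rfl
  let Q := (W \ I).erase v
  have hQ : ∀ q ∈ Q, q ≠ v ∧ q ∈ W ∧ q ∉ I := fun q hq => by
    have := Finset.mem_erase.1 hq
    exact ⟨this.1, Finset.mem_sdiff.1 this.2⟩
  have hQW : Q ⊆ W := fun q hq => (hQ q hq).2.1
  have hvQ : v ∉ Q := Finset.notMem_erase _ _
  rcases Q.eq_empty_or_nonempty with hQe | hQne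
  · have hall : ∀ b ∈ W.erase v, b ∈ I := by
      intro b hb
      by_contra hbI
      have : b ∈ Q := Finset.mem_erase.2 ⟨(Finset.mem_erase.1 hb).1,
        Finset.mem_sdiff.2 ⟨(Finset.mem_erase.1 hb).2, hbI⟩⟩
      rw [hQe] at this
      exact absurd this (Finset.notMem_empty _)
    refine ⟨{v}, W.erase v, ?_, by simp, by simp, ⟨i₀, Finset.mem_erase.2 ⟨hne, hi₀⟩⟩, ?_, ?_⟩
    · rw [← Finset.insert_eq, Finset.insert_erase hv]
    · intro a ha b hb c hc hbc
      rw [Finset.mem_singleton] at ha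
      subst ha
      exact (hI b (hall b hb)).2.2 c (Finset.mem_erase.1 hc).2 (Finset.mem_erase.1 hc).1 hbc.symm
    · intro a ha b hb c _ hab
      rw [Finset.mem_singleton] at ha hb
      exact absurd (ha.trans hb.symm) hab
  have hdeg : ∀ w ∈ Q, ∃ z ∈ Q, z ≠ w ∧ E v w z := by
    intro w hw
    obtain ⟨hwv, hwW, hwI⟩ := hQ w hw
    have : ∃ z ∈ W, z ≠ v ∧ z ≠ w ∧ E v w z := by
      by_contra! hcon
      exact hwI (Finset.mem_filter.2 ⟨hwW, hwv, hcon⟩)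
    obtain ⟨z, hzW, hzv, hzw, he⟩ := this
    refine ⟨z, Finset.mem_erase.2 ⟨hzv, Finset.mem_sdiff.2 ⟨hzW, fun hzI => ?_⟩⟩, hzw, he⟩
    exact (hI z hzI).2.2 w hwW hwv hzw.symm (s2 he)
  obtain ⟨u, hu, hdom⟩ := exists_link_dominating hs h2 hW hv hQW hvQ hQne hdeg
  have hIQ : ∀ {i q}, i ∈ I → q ∈ Q → i ≠ q := fun hi hq h => (hQ _ hq).2.2 (h ▸ hi)
  have hviq : ∀ i ∈ I, ∀ q ∈ Q, ¬ E v i q := fun i hi q hq =>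
    (hI i hi).2.2 q (hQ q hq).2.1 (hQ q hq).1 (hIQ hi hq).symm
  have hadj : ∀ i ∈ I, ∀ q ∈ Q, ∀ r ∈ Q, q ≠ r → E v q r → ¬ E q r i := by
    intro i hi q hq r hr hqr he h
    rcases h2 q r v i hqr (hQ q hq).1 (hIQ hi hq).symm (hQ r hr).1 (hIQ hi hr).symm
      (hI i hi).2.1.symm (hs.rot he) h with h | h
    · exact hviq i hi q hq (s2 (s1 h))
    · exact hviq i hi r hr (s2 (s1 h))
  have hiqq : ∀ i ∈ I, ∀ q ∈ Q, ∀ r ∈ Q, q ≠ r → ¬ E q r i := by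
    intro i hi q hq r hr hqr h
    by_cases he : E v q r
    · exact hadj i hi q hq r hr hqr he h
    have hqu : q ≠ u := by rintro rfl; exact he (hdom r hr hqr.symm)
    have hru : r ≠ u := by rintro rfl; exact he (s2 (hdom q hq hqr))
    -- A pair q, r not adjacent in the link is reduced to an adjacent one through the dominating
    -- vertex u: the edges uqr and qri force iuq or iur, and uq, ur are adjacent.
    have huqr : E u q r := (h2 v u q r (hQ u hu).1.symm (hQ q hq).1.symm (hQ r hr).1.symm
      hqu.symm hru.symm hqr (hdom q hq hqu) (hdom r hr hru)).resolve_left he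
    rcases h2 q r u i hqr hqu (hIQ hi hq).symm hru (hIQ hi hr).symm (hIQ hi hu).symm
      (hs.rot huqr) h with h | h
    · exact hadj i hi u hu q hq hqu.symm (hdom q hq hqu) (s1 h)
    · exact hadj i hi u hu r hr hru.symm (hdom r hr hru) (s1 h)
  have hB : ∀ b ∈ W \ I, b = v ∨ b ∈ Q := fun b hb => by
    by_cases h : b = v
    · exact Or.inl h
    · exact Or.inr (Finset.mem_erase.2 ⟨h, hb⟩)
  refine ⟨I, W \ I, Finset.union_sdiff_of_subset hIW, Finset.disjoint_sdiff, ⟨i₀, hi₀I⟩,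
    ⟨v, Finset.mem_sdiff.2 ⟨hv, hvI⟩⟩, ?_, ?_⟩
  · intro i hi b hb c hc hbc he
    rcases hB b hb with rfl | hbQ
    · rcases hB c hc with rfl | hcQ
      · exact hbc rfl
      · exact hviq i hi c hcQ (s1 he)
    · rcases hB c hc with rfl | hcQ
      · exact hviq i hi b hbQ (s1 (s2 he))
      · exact hiqq i hi b hbQ c hcQ hbc (hs.rot he)
  · intro i hi j hj b hb hij he
    rcases hB b hb with rfl | hbQ
    · exact (hI i hi).2.2 j (hIW hj) (hI j hj).2.1 hij.symm (hs.rot (hs.rot he))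
    · obtain ⟨w, hwQ, hwb, hvbw⟩ := hdeg b hbQ
      refine (hW b (hQW hbQ) i (hIW hi) j (hIW hj) v hv w (hQW hwQ)).1
        ⟨?_, hs.rot (hs.rot he), s1 hvbw, fun h => hviq i hi b hbQ (s1 (hs.rot h)),
        fun h => hiqq i hi b hbQ w hwQ hwb.symm (s2 h),
        fun h => hviq j hj b hbQ (s1 (hs.rot h)),
        fun h => hiqq j hj b hbQ w hwQ hwb.symm (s2 h)⟩
      simp [(hIQ hi hbQ).symm, (hIQ hj hbQ).symm, (hQ b hbQ).1, hwb.symm, hij, (hI i hi).2.1,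
        (hI j hj).2.1, hIQ hi hwQ, hIQ hj hwQ, (hQ w hwQ).1.symm]

/-- A threshold graph has an isolated or a dominating vertex, and a dominating vertex is isolated in
the complement. -/
theorem exists_holdsAcross {E : V → V → V → Prop} (hs : Symm3 E) (h2 : NoTwo E)
    {W : Finset V} (hW : BowtieFreeOn E W) (hcard : 2 ≤ W.card) :
    ∃ A B : Finset V, A ∪ B = W ∧ Disjoint A B ∧ A.Nonempty ∧ B.Nonempty ∧
      (HoldsAcross E A B ∨ HoldsAcross (Compl3 E) A B) := by
  obtain ⟨v, hv⟩ := Finset.card_pos.1 (show 0 < W.card by omega)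
  by_cases hiso : ∃ i ∈ W, i ≠ v ∧ ∀ z ∈ W, z ≠ v → z ≠ i → ¬ E v i z
  · obtain ⟨i, hi, hiv, h⟩ := hiso
    obtain ⟨A, B, h3, h4, h5, h6, h7⟩ := exists_holdsAcross_of_isolated hs h2 hW hv hi hiv h
    exact ⟨A, B, h3, h4, h5, h6, Or.inr h7⟩
  · push Not at hiso
    obtain ⟨u, hu, hdom⟩ := exists_link_dominating hs h2 hW hv (Finset.erase_subset v W)
      (Finset.notMem_erase _ _) (Finset.card_pos.1 (by rw [Finset.card_erase_of_mem hv]; omega))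
      (fun w hw => by
        rw [Finset.mem_erase] at hw
        obtain ⟨z, hz, hzv, hzw, he⟩ := hiso w hw.2 hw.1
        exact ⟨z, Finset.mem_erase.2 ⟨hzv, hz⟩, hzw, he⟩)
    rw [Finset.mem_erase] at hu
    obtain ⟨A, B, h3, h4, h5, h6, h7⟩ := exists_holdsAcross_of_isolated hs.compl (h2.compl hs)
      hW.compl hv hu.2 hu.1 fun z hz hzv hzu h => h (hdom z (Finset.mem_erase.2 ⟨hzv, hz⟩) hzu)
    rw [Symm3.compl_compl] at h7
    exact ⟨A, B, h3, h4, h5, h6, Or.inl h7⟩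

theorem HoldsOn.union {E : V → V → V → Prop} (hs : Symm3 E) {A B S T : Finset V}
    (h : HoldsAcross E A B) (hSA : S ⊆ A) (hTB : T ⊆ B) (hS : HoldsOn E S) (hT : HoldsOn E T) :
    HoldsOn E (S ∪ T) := by
  intro x hx y hy z hz hxy hxz hyz
  rcases Finset.mem_union.1 hx with hx | hx <;> rcases Finset.mem_union.1 hy with hy | hy <;>
    rcases Finset.mem_union.1 hz with hz | hz
  · exact hS x hx y hy z hz hxy hxz hyz
  · exact h.2 x (hSA hx) y (hSA hy) z (hTB hz) hxy
  · exact hs.swap23 (h.2 x (hSA hx) z (hSA hz) y (hTB hy) hxz)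
  · exact h.1 x (hSA hx) y (hTB hy) z (hTB hz) hyz
  · exact hs.rot (hs.rot (h.2 y (hSA hy) z (hSA hz) x (hTB hx) hyz))
  · exact hs.swap12 (h.1 y (hSA hy) x (hTB hx) z (hTB hz) hxz)
  · exact hs.rot (h.1 z (hSA hz) x (hTB hx) y (hTB hy) hxy)
  · exact hT x hx y hy z hz hxy hxz hyz

/-- Across a split, sets of the matching type are united, and the larger of the two sets of the
other type is kept: |S||T| + |S'||T'| ≤ (|S| + |S'|) max(|T|, |T'|). -/
theorem exists_card_le_mul_of_bowtieFreeOn {E : V → V → V → Prop} (hs : Symm3 E) (h2 : NoTwo E)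
    (W : Finset V) (hW : BowtieFreeOn E W) :
    ∃ S ⊆ W, ∃ T ⊆ W, HoldsOn E S ∧ HoldsOn (Compl3 E) T ∧ W.card ≤ S.card * T.card := by
  induction W using Finset.strongInduction with
  | H W ih =>
    by_cases hcard : 2 ≤ W.card
    · obtain ⟨A, B, hAB, hdisj, hA, hB, hcross⟩ := exists_holdsAcross hs h2 hW hcard
      have hAW : A ⊆ W := hAB ▸ Finset.subset_union_left
      have hBW : B ⊆ W := hAB ▸ Finset.subset_union_right
      have hAlt : A ⊂ W := by
        refine Finset.ssubset_iff_subset_ne.2 ⟨hAW, fun h => ?_⟩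
        obtain ⟨b, hb⟩ := hB
        exact Finset.disjoint_left.1 hdisj (h ▸ hBW hb) hb
      have hBlt : B ⊂ W := by
        refine Finset.ssubset_iff_subset_ne.2 ⟨hBW, fun h => ?_⟩
        obtain ⟨a, ha⟩ := hA
        exact Finset.disjoint_left.1 hdisj ha (h ▸ hAW ha)
      obtain ⟨S, hSA, T, hTA, hS, hT, hc⟩ := ih A hAlt (hW.mono hAW)
      obtain ⟨S', hSB, T', hTB, hS', hT', hc'⟩ := ih B hBlt (hW.mono hBW)
      have hsum : W.card = A.card + B.card := by rw [← hAB, Finset.card_union_of_disjoint hdisj]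
      rcases hcross with hcross | hcross
      · have hcu : (S ∪ S').card = S.card + S'.card :=
          Finset.card_union_of_disjoint (Finset.disjoint_of_subset_left hSA
            (Finset.disjoint_of_subset_right hSB hdisj))
        have hSS := HoldsOn.union hs hcross hSA hSB hS hS'
        have hsub : S ∪ S' ⊆ W := Finset.union_subset (hSA.trans hAW) (hSB.trans hBW)
        rcases le_total T.card T'.card with hle | hle
        · exact ⟨S ∪ S', hsub, T', hTB.trans hBW, hSS, hT', by rw [hsum, hcu]; nlinarith⟩
        · exact ⟨S ∪ S', hsub, T, hTA.trans hAW, hSS, hT, by rw [hsum, hcu]; nlinarith⟩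
      · have hcu : (T ∪ T').card = T.card + T'.card :=
          Finset.card_union_of_disjoint (Finset.disjoint_of_subset_left hTA
            (Finset.disjoint_of_subset_right hTB hdisj))
        have hTT := HoldsOn.union hs.compl hcross hTA hTB hT hT'
        have hsub : T ∪ T' ⊆ W := Finset.union_subset (hTA.trans hAW) (hTB.trans hBW)
        rcases le_total S.card S'.card with hle | hle
        · exact ⟨S', hSB.trans hBW, T ∪ T', hsub, hS', hTT, by rw [hsum, hcu]; nlinarith⟩
        · exact ⟨S, hSA.trans hAW, T ∪ T', hsub, hS, hTT, by rw [hsum, hcu]; nlinarith⟩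
    · have htriv : ∀ P : V → V → V → Prop, HoldsOn P W := by
        intro P x hx y hy z _ hxy
        exact absurd (Finset.card_le_one.1 (by omega) x hx y hy) hxy
      refine ⟨W, subset_rfl, W, subset_rfl, htriv _, htriv _, ?_⟩
      nlinarith [Nat.le_mul_self W.card]

theorem NoTwo.card_le [Fintype V] {E : V → V → V → Prop} (hs : Symm3 E) (h2 : NoTwo E) {h : ℕ}
    (hom : ∀ S : Finset V, HoldsOn E S ∨ HoldsOn (Compl3 E) S → S.card ≤ h) :
    Fintype.card V ≤ 2 * (h ^ 2 + 1) ^ 5 := by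
  by_contra! hN
  obtain ⟨W, hWc, hW⟩ := exists_bowtie_free hs h2 hN
  obtain ⟨S, -, T, -, hS, hT, hc⟩ := exists_card_le_mul_of_bowtieFreeOn hs h2 W hW
  have h3 := Nat.mul_le_mul (hom S (Or.inl hS)) (hom T (Or.inr hT))
  nlinarith

end NoTwo

theorem exists_rpow_lt_minHomNumber_four_two :
    ∃ c : ℝ, 0 < c ∧ ∀ n : ℕ, 2 ≤ n → (n : ℝ) ^ c < (minHomNumber 3 n {(4, 2)} : ℝ) := by
  -- The argument gives n ≤ h^16; the exponent 17 makes the inequality strict.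
  refine ⟨1 / 17, by norm_num, fun n hn => ?_⟩
  obtain ⟨H, hfree, hH⟩ := exists_homNumber_eq_minHomNumber n 4 2 two_ne_zero
  rw [← hH]
  have h2 : 2 ≤ H.homNumber := H.two_le_homNumber (by rw [Fintype.card_fin]; omega)
  have h3 := NoTwo.card_le H.symm3_adj3 (RGraph.noTwo_adj3 hfree)
    fun S hS => H.card_le_homNumber hS
  rw [Fintype.card_fin] at h3
  set h := H.homNumber
  have h4 : n ≤ h ^ 16 := by
    have h5 : h ^ 2 + 1 ≤ h ^ 3 := by
      have : 2 * h ^ 2 ≤ h * h ^ 2 := Nat.mul_le_mul_right _ h2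
      nlinarith
    calc n ≤ 2 * (h ^ 2 + 1) ^ 5 := h3
      _ ≤ h * (h ^ 3) ^ 5 := Nat.mul_le_mul h2 (Nat.pow_le_pow_left h5 5)
      _ = h ^ 16 := by ring
  have h6 : n < h ^ 17 := h4.trans_lt (Nat.pow_lt_pow_right (by omega) (by norm_num))
  have h7 : (n : ℝ) < (h : ℝ) ^ (17 : ℕ) := by exact_mod_cast h6
  calc (n : ℝ) ^ (1 / 17 : ℝ) < ((h : ℝ) ^ (17 : ℕ)) ^ (1 / 17 : ℝ) :=
        Real.rpow_lt_rpow (by positivity) h7 (by norm_num)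
    _ = h := by
      rw [← Real.rpow_natCast, ← Real.rpow_mul (by positivity)]
      norm_num

/-! ### Graph containers. -/

section Containers

/-- If every large subset of `A₀` has a vertex of relative degree at least `β`, then the
independent sets are covered by few small sets. -/
theorem exists_containers {V : Type*} [DecidableEq V] (L : V → V → Prop) {β : ℝ}
    (hβ1 : β ≤ 1) {R : ℕ} {A₀ : Finset V}
    (hdeg : ∀ A ⊆ A₀, R < A.card → ∃ v ∈ A, ∃ N ⊆ A, (∀ x ∈ N, x ≠ v ∧ L v x) ∧
      β * A.card ≤ N.card) (j : ℕ) (A : Finset V) (hA : A ⊆ A₀)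
    (hj : (1 - β) ^ j * A.card ≤ R) :
    ∃ F : Finset (Finset V), F.card ≤ (A.card + 1) ^ j ∧ (∀ C ∈ F, C.card ≤ R + j) ∧
      ∀ I ⊆ A, (∀ x ∈ I, ∀ y ∈ I, x ≠ y → ¬ L x y) → ∃ C ∈ F, I ⊆ C := by
  induction j generalizing A with
  | zero =>
    refine ⟨{A}, by simp, ?_, fun I hI _ => ⟨A, by simp, hI⟩⟩
    intro C hC
    rw [Finset.mem_singleton.1 hC]
    rw [pow_zero, one_mul] at hj
    exact_mod_cast hj
  | succ j ihj =>
    -- The outer induction counts how often the chosen vertex v may still lie in I, each occurrence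
    -- shrinking A by the factor 1 - β; the inner one handles v ∉ I, where A loses only v.
    induction A using Finset.strongInduction with
    | H A ih =>
      rcases le_or_gt A.card R with hAR | hAR
      · refine ⟨{A}, ?_, ?_, fun I hI _ => ⟨A, by simp, hI⟩⟩
        · rw [Finset.card_singleton]
          exact Nat.one_le_pow' _ _
        · intro C hC
          rw [Finset.mem_singleton.1 hC]
          omega
      obtain ⟨v, hv, N, hN, hNL, hcard⟩ := hdeg A hA hAR
      have h1β : 0 ≤ 1 - β := by linarith
      obtain ⟨F₁, hF₁c, hF₁s, hF₁⟩ := ih (A.erase v) (Finset.erase_ssubset hv)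
        ((Finset.erase_subset _ _).trans hA) (by
          refine le_trans ?_ hj
          gcongr
          exact Finset.erase_subset _ _)
      have hsub : (A \ N).erase v ⊆ A := (Finset.erase_subset _ _).trans Finset.sdiff_subset
      have hsub' : (A \ N).erase v ⊆ A.erase v := Finset.erase_subset_erase _ Finset.sdiff_subset
      obtain ⟨F₂, hF₂c, hF₂s, hF₂⟩ := ihj ((A \ N).erase v) (hsub.trans hA) (by
          refine le_trans ?_ hj
          rw [pow_succ, mul_assoc]
          gcongr
          have h1 : (((A \ N).erase v).card : ℝ) ≤ (A \ N).card := by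
            exact_mod_cast Finset.card_le_card (Finset.erase_subset _ _)
          have h2 : ((A \ N).card : ℝ) + N.card = A.card := by
            exact_mod_cast Finset.card_sdiff_add_card_eq_card hN
          linarith)
      have hApos : 0 < A.card := Finset.card_pos.2 ⟨v, hv⟩
      have hAe : (A.erase v).card + 1 = A.card := Finset.card_erase_add_one hv
      refine ⟨F₁ ∪ F₂.image (insert v), ?_, ?_, ?_⟩
      · have h3 : ((A \ N).erase v).card + 1 ≤ A.card := by
          have := Finset.card_le_card hsub'
          omega
        calc (F₁ ∪ F₂.image (insert v)).card ≤ F₁.card + F₂.card :=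
              (Finset.card_union_le _ _).trans (Nat.add_le_add_left Finset.card_image_le _)
          _ ≤ A.card ^ (j + 1) + A.card ^ j := by
            refine Nat.add_le_add (by rwa [hAe] at hF₁c) (hF₂c.trans (Nat.pow_le_pow_left h3 j))
          _ = A.card ^ j * (A.card + 1) := by ring
          _ ≤ (A.card + 1) ^ j * (A.card + 1) :=
            Nat.mul_le_mul_right _ (Nat.pow_le_pow_left (Nat.le_succ _) j)
          _ = _ := by ring
      · intro C hC
        rcases Finset.mem_union.1 hC with hC | hC
        · exact hF₁s C hC
        · obtain ⟨D, hD, rfl⟩ := Finset.mem_image.1 hC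
          have := Finset.card_insert_le v D
          have := hF₂s D hD
          omega
      · intro I hI hind
        by_cases hvI : v ∈ I
        · obtain ⟨C, hC, hIC⟩ := hF₂ (I.erase v) (by
            intro x hx
            rw [Finset.mem_erase] at hx
            refine Finset.mem_erase.2 ⟨hx.1, Finset.mem_sdiff.2 ⟨hI hx.2, fun hxN => ?_⟩⟩
            exact hind v hvI x hx.2 hx.1.symm (hNL x hxN).2)
            fun x hx y hy => hind x (Finset.mem_of_mem_erase hx) y (Finset.mem_of_mem_erase hy)
          refine ⟨insert v C, Finset.mem_union_right _ (Finset.mem_image_of_mem _ hC), ?_⟩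
          rw [← Finset.insert_erase hvI]
          exact Finset.insert_subset_insert _ hIC
        · obtain ⟨C, hC, hIC⟩ := hF₁ I (Finset.subset_erase.2 ⟨hI, hvI⟩) hind
          exact ⟨C, Finset.mem_union_left _ hC, hIC⟩

end Containers

/-! ### Lines and arcs in a finite affine plane. -/

section Plane

variable {K : Type*} [Field K]

/-- Collinearity of three points of the affine plane. -/
def Collin (a b c : K × K) : Prop :=
  (b.1 - a.1) * (c.2 - a.2) = (b.2 - a.2) * (c.1 - a.1)

theorem symm3_collin : Symm3 (Collin (K := K)) := by
  constructor
  · intro x y z h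
    unfold Collin at *
    linear_combination -h
  · intro x y z h
    unfold Collin at *
    linear_combination -h

theorem Collin.exists_param {x y a : K × K} (hxy : x ≠ y) (h : Collin x y a) :
    ∃ s : K, a = (x.1 + s * (y.1 - x.1), x.2 + s * (y.2 - x.2)) := by
  unfold Collin at h
  by_cases h1 : y.1 - x.1 = 0
  · have h2 : y.2 - x.2 ≠ 0 := fun h2 =>
      hxy (Prod.ext (sub_eq_zero.1 h1).symm (sub_eq_zero.1 h2).symm)
    refine ⟨(a.2 - x.2) / (y.2 - x.2), Prod.ext ?_ ?_⟩
    · simp only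
      field_simp
      linear_combination -h
    · simp only
      field_simp
      ring
  · refine ⟨(a.1 - x.1) / (y.1 - x.1), Prod.ext ?_ ?_⟩
    · simp only
      field_simp
      ring
    · simp only
      field_simp
      linear_combination h

theorem Collin.of_line {x y a b c : K × K} (hxy : x ≠ y) (ha : Collin x y a) (hb : Collin x y b)
    (hc : Collin x y c) : Collin a b c := by
  obtain ⟨r, rfl⟩ := ha.exists_param hxy
  obtain ⟨s, rfl⟩ := hb.exists_param hxy
  obtain ⟨t, rfl⟩ := hc.exists_param hxy
  unfold Collin
  ring

open Classical in
/-- The slope of the line through two points. -/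
noncomputable def slopeAt (u x : K × K) : Option K :=
  if x.1 = u.1 then none else some ((x.2 - u.2) / (x.1 - u.1))

theorem collin_of_slopeAt_eq {u x y : K × K} (h : slopeAt u x = slopeAt u y) : Collin u x y := by
  unfold slopeAt at h
  unfold Collin
  split_ifs at h with h1 h2 h2
  · rw [h1, h2]; ring
  · have h3 : x.1 - u.1 ≠ 0 := sub_ne_zero.2 h1
    have h4 : y.1 - u.1 ≠ 0 := sub_ne_zero.2 h2
    have h5 := Option.some.inj h
    rw [div_eq_div_iff h3 h4] at h5
    linear_combination -h5

variable [Fintype K] [DecidableEq K]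

open Classical in
theorem card_line_le {x y : K × K} (hxy : x ≠ y) :
    (Finset.univ.filter fun a => Collin x y a).card ≤ Fintype.card K := by
  calc _ ≤ ((Finset.univ : Finset K).image
        fun s => (x.1 + s * (y.1 - x.1), x.2 + s * (y.2 - x.2))).card := by
        apply Finset.card_le_card
        intro a ha
        obtain ⟨s, hs⟩ := (Finset.mem_filter.1 ha).2.exists_param hxy
        exact Finset.mem_image.2 ⟨s, Finset.mem_univ _, hs.symm⟩
    _ ≤ _ := Finset.card_image_le

-- Cauchy–Schwarz over the q + 1 slopes at u; `Option K` lists them, with `none` for the vertical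
-- one (and for u itself).
open Classical in
theorem sq_card_le_mul_card_collin (u : K × K) (A : Finset (K × K)) :
    A.card ^ 2 ≤ (Fintype.card K + 1) *
      ((A ×ˢ A).filter fun p => Collin u p.1 p.2).card := by
  have h1 : A.card = ∑ i : Option K, (A.filter fun x => slopeAt u x = i).card :=
    Finset.card_eq_sum_card_fiberwise fun _ _ => Finset.mem_coe.2 (Finset.mem_univ _)
  have h2 : ((A ×ˢ A).filter fun p => slopeAt u p.1 = slopeAt u p.2).card =
      ∑ i : Option K, (A.filter fun x => slopeAt u x = i).card ^ 2 := by
    rw [Finset.card_eq_sum_card_fiberwise (f := fun p => slopeAt u p.1) (t := Finset.univ)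
      fun _ _ => Finset.mem_coe.2 (Finset.mem_univ _)]
    refine Finset.sum_congr rfl fun i _ => ?_
    rw [sq, ← Finset.card_product]
    congr 1
    ext p
    simp only [Finset.mem_filter, Finset.mem_product]
    grind
  have h3 := sq_sum_le_card_mul_sum_sq (s := (Finset.univ : Finset (Option K)))
    (f := fun i => (A.filter fun x => slopeAt u x = i).card)
  rw [← h1, ← h2, Finset.card_univ, Fintype.card_option] at h3
  refine h3.trans (Nat.mul_le_mul_left _ (Finset.card_le_card ?_))
  intro p hp
  rw [Finset.mem_filter] at hp ⊢
  exact ⟨hp.1, collin_of_slopeAt_eq hp.2⟩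

-- Each u in T contributes at least (3/4)|A|²/(q+1) ordered pairs collinear with it, the diagonal
-- being negligible for large A. A pair is counted at most twice, as its line holds at most two
-- points of the arc T. The average degree then exceeds the bound.
open Classical in
theorem exists_degree_ge {T A : Finset (K × K)} (hT : HoldsOn (Compl3 Collin) T)
    (hA : 4 * (Fintype.card K + 1) < A.card) :
    ∃ v ∈ A, (T.card / (4 * (Fintype.card K + 1)) : ℝ) * A.card ≤
      (A.filter fun y => y ≠ v ∧ ∃ u ∈ T, Collin u v y).card := by
  set q := Fintype.card K
  by_contra! hcon
  have hApos : 0 < A.card := by omega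
  let G := (A ×ˢ A).filter fun p => p.2 ≠ p.1 ∧ ∃ u ∈ T, Collin u p.1 p.2
  have hG : G.card = ∑ v ∈ A, (A.filter fun y => y ≠ v ∧ ∃ u ∈ T, Collin u v y).card := by
    rw [Finset.card_eq_sum_card_fiberwise (f := Prod.fst) (t := A)
      fun p hp => (Finset.mem_product.1 (Finset.mem_filter.1 hp).1).1]
    refine Finset.sum_congr rfl fun v hv => ?_
    apply Finset.card_bij (fun p _ => p.2)
    · intro p hp
      simp only [Finset.mem_filter, Finset.mem_product] at hp ⊢
      obtain ⟨⟨hp1, hp2⟩, rfl⟩ := hp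
      exact ⟨hp1.2, hp2⟩
    · intro p hp p' hp' h
      simp only [Finset.mem_filter] at hp hp'
      exact Prod.ext (hp.2.trans hp'.2.symm) h
    · intro y hy
      rw [Finset.mem_filter] at hy
      refine ⟨(v, y), ?_, rfl⟩
      exact Finset.mem_filter.2
        ⟨Finset.mem_filter.2 ⟨Finset.mem_product.2 ⟨hv, hy.1⟩, hy.2⟩, rfl⟩
  have hoff : ∀ u, A.card ^ 2 ≤ (q + 1) *
      (((A ×ˢ A).filter fun p => p.2 ≠ p.1 ∧ Collin u p.1 p.2).card + A.card) := by
    intro u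
    refine (sq_card_le_mul_card_collin u A).trans (Nat.mul_le_mul_left _ ?_)
    calc _ ≤ (((A ×ˢ A).filter fun p => p.2 ≠ p.1 ∧ Collin u p.1 p.2) ∪
          A.image fun x => (x, x)).card := by
          apply Finset.card_le_card
          intro p hp
          rw [Finset.mem_filter, Finset.mem_product] at hp
          rw [Finset.mem_union, Finset.mem_filter, Finset.mem_product, Finset.mem_image]
          by_cases h : p.2 = p.1
          · exact Or.inr ⟨p.1, hp.1.1, Prod.ext rfl h.symm⟩
          · exact Or.inl ⟨hp.1, h, hp.2⟩
      _ ≤ _ := (Finset.card_union_le _ _).trans (Nat.add_le_add_left Finset.card_image_le _)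
  have hdouble : ∑ u ∈ T, ((A ×ˢ A).filter fun p => p.2 ≠ p.1 ∧ Collin u p.1 p.2).card ≤
      2 * G.card := by
    have h1 : ∀ u ∈ T, ((A ×ˢ A).filter fun p => p.2 ≠ p.1 ∧ Collin u p.1 p.2).card =
        ∑ p ∈ G, if Collin u p.1 p.2 then 1 else 0 := by
      intro u hu
      rw [← Finset.card_filter]
      congr 1
      ext p
      simp only [G, Finset.mem_filter]
      constructor
      · rintro ⟨h1, h2, h3⟩
        exact ⟨⟨h1, h2, u, hu, h3⟩, h3⟩
      · rintro ⟨⟨h1, h2, -⟩, h3⟩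
        exact ⟨h1, h2, h3⟩
    rw [Finset.sum_congr rfl h1, Finset.sum_comm, mul_comm, ← smul_eq_mul, ← Finset.sum_const]
    refine Finset.sum_le_sum fun p hp => ?_
    rw [← Finset.card_filter]
    by_contra! hlt
    obtain ⟨a, b, c, ha, hb, hc, hab, hac, hbc⟩ := Finset.two_lt_card_iff.1 hlt
    rw [Finset.mem_filter] at ha hb hc
    have hne := (Finset.mem_filter.1 hp).2.1
    exact hT a ha.1 b hb.1 c hc.1 hab hac hbc (Collin.of_line hne.symm
      (symm3_collin.rot ha.2) (symm3_collin.rot hb.2) (symm3_collin.rot hc.2))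
  have hAr : (0 : ℝ) < A.card := by exact_mod_cast hApos
  have hq : (0 : ℝ) < (q : ℝ) + 1 := by positivity
  have hAr' : 4 * ((q : ℝ) + 1) < A.card := by exact_mod_cast hA
  have hlow : (T.card : ℝ) * (3 / 4 * (A.card : ℝ) ^ 2 / (q + 1)) ≤ 2 * G.card := by
    refine le_trans ?_ (show ((∑ u ∈ T, ((A ×ˢ A).filter fun p => p.2 ≠ p.1 ∧
      Collin u p.1 p.2).card : ℕ) : ℝ) ≤ 2 * G.card by exact_mod_cast hdouble)
    rw [Nat.cast_sum, ← nsmul_eq_mul, ← Finset.sum_const]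
    refine Finset.sum_le_sum fun u _ => ?_
    have := hoff u
    have h2 : (A.card : ℝ) ^ 2 ≤ (q + 1) *
      (((A ×ˢ A).filter fun p => p.2 ≠ p.1 ∧ Collin u p.1 p.2).card + A.card) := by
      exact_mod_cast this
    rw [div_le_iff₀ hq]
    nlinarith
  have hup : (G.card : ℝ) ≤ T.card / (4 * (q + 1)) * (A.card : ℝ) ^ 2 := by
    rw [hG, Nat.cast_sum]
    calc _ ≤ ∑ v ∈ A, (T.card / (4 * (q + 1)) : ℝ) * A.card :=
          Finset.sum_le_sum fun v hv => (hcon v hv).le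
      _ = _ := by rw [Finset.sum_const, nsmul_eq_mul]; ring
  rcases Nat.eq_zero_or_pos T.card with hT0 | hT0
  · obtain ⟨v, hv⟩ := Finset.card_pos.1 hApos
    have := hcon v hv
    rw [hT0] at this
    simp only [Nat.cast_zero, zero_div, zero_mul] at this
    exact absurd this (not_lt.2 (Nat.cast_nonneg _))
  · have hT' : (0 : ℝ) < T.card := by exact_mod_cast hT0
    have h5 : (T.card : ℝ) * (3 / 4 * (A.card : ℝ) ^ 2 / (q + 1)) =
        3 * (T.card / (4 * (q + 1)) * (A.card : ℝ) ^ 2) := by field_simp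
    have h6 : 0 < T.card / (4 * ((q : ℝ) + 1)) * (A.card : ℝ) ^ 2 := by positivity
    linarith

/-- Arcs with at least `t` points are covered by few sets of size linear in the order of the
field. -/
theorem exists_arc_containers {t j : ℕ} (ht : t ≤ 4 * (Fintype.card K + 1))
    (hj : (1 - t / (4 * (Fintype.card K + 1)) : ℝ) ^ j * (Fintype.card K) ^ 2 ≤
      4 * (Fintype.card K + 1)) :
    ∃ F : Finset (Finset (K × K)),
      F.card ≤ (Fintype.card K ^ 2) ^ t * (Fintype.card K ^ 2 + 1) ^ j ∧
      (∀ C ∈ F, C.card ≤ 4 * (Fintype.card K + 1) + j + t) ∧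
      ∀ S : Finset (K × K), HoldsOn (Compl3 Collin) S → t ≤ S.card → ∃ C ∈ F, S ⊆ C := by
  classical
  set q := Fintype.card K with hq
  have hN : Fintype.card (K × K) = q ^ 2 := by rw [Fintype.card_prod, sq]
  have hβ1 : (t / (4 * (q + 1)) : ℝ) ≤ 1 := by
    rw [div_le_one (by positivity)]
    exact_mod_cast ht
  -- The rest of an arc containing T is independent in the graph joining points collinear with some
  -- point of T. For other T any family serves, so the families can be chosen for all T at once.
  have key : ∀ T : Finset (K × K), ∃ F : Finset (Finset (K × K)), F.card ≤ (q ^ 2 + 1) ^ j ∧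
      (∀ C ∈ F, C.card ≤ 4 * (q + 1) + j) ∧
      (T.card = t → HoldsOn (Compl3 Collin) T → ∀ S : Finset (K × K), T ⊆ S →
        HoldsOn (Compl3 Collin) S → ∃ C ∈ F, S \ T ⊆ C) := by
    intro T
    by_cases hT : T.card = t ∧ HoldsOn (Compl3 Collin) T
    · have hTc : (Tᶜ.card : ℝ) ≤ (q : ℝ) ^ 2 := by
        have h := Finset.card_le_univ (Tᶜ : Finset (K × K))
        rw [hN] at h
        exact_mod_cast h
      obtain ⟨F, hF1, hF2, hF3⟩ := exists_containers
        (L := fun x y : K × K => ∃ u ∈ T, Collin u x y) (β := t / (4 * (q + 1)))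
        (R := 4 * (q + 1)) (A₀ := Tᶜ) hβ1 (by
          intro A _ hA'
          obtain ⟨v, hv, h⟩ := exists_degree_ge hT.2 hA'
          rw [hT.1] at h
          refine ⟨v, hv, _, Finset.filter_subset _ _, fun x hx => (Finset.mem_filter.1 hx).2, h⟩)
        j Tᶜ subset_rfl (by
          push_cast
          refine le_trans ?_ hj
          gcongr)
      refine ⟨F, hF1.trans (Nat.pow_le_pow_left (by
        have : Tᶜ.card ≤ q ^ 2 := by exact_mod_cast hTc
        omega) j), hF2, fun _ _ S hTS hS => hF3 _ ?_ ?_⟩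
      · intro x hx
        exact Finset.mem_compl.2 (Finset.mem_sdiff.1 hx).2
      · rintro x hx y hy hxy ⟨u, hu, hcol⟩
        rw [Finset.mem_sdiff] at hx hy
        exact hS u (hTS hu) x hx.1 y hy.1 (fun h => hx.2 (h ▸ hu)) (fun h => hy.2 (h ▸ hu)) hxy hcol
    · exact ⟨∅, by simp, by simp, fun h1 h2 => absurd ⟨h1, h2⟩ hT⟩
  choose F hF1 hF2 hF3 using key
  refine ⟨(Finset.powersetCard t Finset.univ).biUnion fun T => (F T).image fun C => C ∪ T,
    ?_, ?_, ?_⟩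
  · refine (Finset.card_biUnion_le_card_mul _ _ ((q ^ 2 + 1) ^ j) fun T _ =>
      Finset.card_image_le.trans (hF1 T)).trans (Nat.mul_le_mul_right _ ?_)
    rw [Finset.card_powersetCard, Finset.card_univ, hN]
    exact Nat.choose_le_pow _ _
  · intro C hC
    obtain ⟨T, hT, hC⟩ := Finset.mem_biUnion.1 hC
    obtain ⟨D, hD, rfl⟩ := Finset.mem_image.1 hC
    have h1 := Finset.card_union_le D T
    have h2 := hF2 T D hD
    have h3 := (Finset.mem_powersetCard.1 hT).2
    omega
  · intro S hS hts
    obtain ⟨T, hTS, hT⟩ := Finset.exists_subset_card_eq hts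
    obtain ⟨C, hC, hsub⟩ := hF3 T hT (hS.mono hTS) S hTS hS
    refine ⟨C ∪ T, Finset.mem_biUnion.2 ⟨T, Finset.mem_powersetCard.2 ⟨Finset.subset_univ _, hT⟩,
      Finset.mem_image_of_mem _ hC⟩, ?_⟩
    intro x hx
    by_cases h : x ∈ T
    · exact Finset.mem_union_right _ h
    · exact Finset.mem_union_left _ (hsub (Finset.mem_sdiff.2 ⟨hx, h⟩))

/-- A set of `n` points of the plane with neither `k` collinear points nor an arc of size `k`. -/
theorem exists_no_large_line_or_arc {t j k n : ℕ} (hk : 3 ≤ k) (htk : t ≤ k)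
    (ht : t ≤ 4 * (Fintype.card K + 1))
    (hj : (1 - t / (4 * (Fintype.card K + 1)) : ℝ) ^ j * (Fintype.card K) ^ 2 ≤
      4 * (Fintype.card K + 1)) (hn : n ≤ Fintype.card K ^ 2)
    (hcount : ((Fintype.card K ^ 2) ^ t * (Fintype.card K ^ 2 + 1) ^ j + Fintype.card K ^ 4) *
      (4 * (Fintype.card K + 1) + j + t).choose k * n ^ k < (Fintype.card K ^ 2) ^ k) :
    ∃ W : Finset (K × K), W.card = n ∧
      ∀ S ⊆ W, HoldsOn Collin S ∨ HoldsOn (Compl3 Collin) S → S.card < k := by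
  classical
  obtain ⟨F, hFc, hFs, hF⟩ := exists_arc_containers ht hj
  set q := Fintype.card K with hq
  have hN : Fintype.card (K × K) = q ^ 2 := by rw [Fintype.card_prod, sq]
  let lines : Finset (Finset (K × K)) :=
    ((Finset.univ : Finset ((K × K) × (K × K))).filter fun p => p.1 ≠ p.2).image
      fun p => Finset.univ.filter fun a => Collin p.1 p.2 a
  have hlc : lines.card ≤ q ^ 4 := by
    refine Finset.card_image_le.trans ((Finset.card_filter_le _ _).trans (le_of_eq ?_))
    rw [Finset.card_univ, Fintype.card_prod, hN]
    ring
  have hsize : ∀ C ∈ F ∪ lines, C.card ≤ 4 * (q + 1) + j + t := by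
    intro C hC
    rcases Finset.mem_union.1 hC with hC | hC
    · exact hFs C hC
    · obtain ⟨p, hp, rfl⟩ := Finset.mem_image.1 hC
      have := card_line_le (Finset.mem_filter.1 hp).2
      omega
  -- The forbidden k-sets are those inside a container or a line; lines are counted crudely, by
  -- pairs of points.
  obtain ⟨W, hW, hno⟩ := exists_card_eq_forall_not_subset
    ((F ∪ lines).biUnion fun C => Finset.powersetCard k C) (k := k) (m := n)
    (fun B hB => by
      obtain ⟨C, -, hC⟩ := Finset.mem_biUnion.1 hB
      exact (Finset.mem_powersetCard.1 hC).2) (by rw [hN]; exact hn) (by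
      rw [hN]
      refine lt_of_le_of_lt (Nat.mul_le_mul_right _ ?_) hcount
      refine (Finset.card_biUnion_le_card_mul _ _ ((4 * (q + 1) + j + t).choose k)
        fun C hC => ?_).trans (Nat.mul_le_mul_right _
          ((Finset.card_union_le _ _).trans (Nat.add_le_add hFc hlc)))
      rw [Finset.card_powersetCard]
      exact Nat.choose_le_choose k (hsize C hC))
  refine ⟨W, hW, fun S hSW hS => ?_⟩
  by_contra! hkS
  have hcover : ∃ C ∈ F ∪ lines, S ⊆ C := by
    rcases hS with hS | hS
    · obtain ⟨x, hx, y, hy, hxy⟩ := Finset.one_lt_card.1 (show 1 < S.card by omega)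
      refine ⟨_, Finset.mem_union_right _ (Finset.mem_image_of_mem _
        (Finset.mem_filter.2 ⟨Finset.mem_univ (x, y), hxy⟩)), fun z hz => ?_⟩
      simp only [Finset.mem_filter, Finset.mem_univ, true_and]
      by_cases hxz : x = z
      · subst hxz; simp [Collin]
      by_cases hyz : y = z
      · subst hyz; unfold Collin; ring
      exact hS x hx y hy z hz hxy hxz hyz
    · obtain ⟨C, hC, hSC⟩ := hF S hS (htk.trans hkS)
      exact ⟨C, Finset.mem_union_left _ hC, hSC⟩
  obtain ⟨C, hC, hSC⟩ := hcover
  obtain ⟨B, hBS, hB⟩ := Finset.exists_subset_card_eq hkS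
  exact hno B (Finset.mem_biUnion.2 ⟨C, hC, Finset.mem_powersetCard.2 ⟨hBS.trans hSC, hB⟩⟩)
    (hBS.trans hSW)

end Plane

/-! ### The 3-graph of collinear triples. -/

section CollinGraph

variable {K V : Type*} [Field K] [Fintype V] [DecidableEq V]

open Classical in
/-- The `3`-graph of collinear triples among the points `f v`. -/
noncomputable def collinGraph (f : V → K × K) : RGraph 3 V where
  edges := (Finset.powersetCard 3 Finset.univ).filter fun e =>
    ∀ x ∈ e, ∀ y ∈ e, ∀ z ∈ e, Collin (f x) (f y) (f z)
  card_of_mem _ he := (Finset.mem_powersetCard.1 (Finset.mem_filter.1 he).1).2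

theorem mem_edges_collinGraph {f : V → K × K} {e : Finset V} :
    e ∈ (collinGraph f).edges ↔
      e.card = 3 ∧ ∀ x ∈ e, ∀ y ∈ e, ∀ z ∈ e, Collin (f x) (f y) (f z) := by
  simp [collinGraph, Finset.mem_powersetCard]

/-- Two edges within four points share two points, so all four points are collinear and span four
edges. -/
theorem collinGraph_isFree {f : V → K × K} (hf : Function.Injective f) :
    (collinGraph f).IsFree {(4, 2)} := by
  rintro p rfl S hS h2
  obtain ⟨e, g, heg, hcard⟩ := Finset.card_eq_two.1 h2
  have he : e ∈ (collinGraph f).inducedEdges S := by rw [hcard]; simp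
  have hg : g ∈ (collinGraph f).inducedEdges S := by rw [hcard]; simp
  simp only [RGraph.inducedEdges, Finset.mem_filter, mem_edges_collinGraph] at he hg
  simp only at hS
  obtain ⟨⟨hec, he⟩, heS⟩ := he
  obtain ⟨⟨hgc, hg⟩, hgS⟩ := hg
  have hsum := Finset.card_union_add_card_inter e g
  have hle := Finset.card_le_card (Finset.union_subset heS hgS)
  have hlt : 3 < (e ∪ g).card := by
    by_contra! h
    have h1 := Finset.eq_of_subset_of_card_le (Finset.subset_union_left (s₁ := e) (s₂ := g))
      (by omega)
    have h3 := Finset.eq_of_subset_of_card_le (Finset.subset_union_right (s₁ := e) (s₂ := g))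
      (by omega)
    exact heg (h1.trans h3.symm)
  have hunion : e ∪ g = S :=
    Finset.eq_of_subset_of_card_le (Finset.union_subset heS hgS) (by omega)
  obtain ⟨x, hx, y, hy, hxy⟩ := Finset.one_lt_card.1 (show 1 < (e ∩ g).card by omega)
  rw [Finset.mem_inter] at hx hy
  have hall : ∀ z ∈ S, Collin (f x) (f y) (f z) := by
    intro z hz
    rw [← hunion, Finset.mem_union] at hz
    rcases hz with hz | hz
    · exact he x hx.1 y hy.1 z hz
    · exact hg x hx.2 y hy.2 z hz
  have hfxy : f x ≠ f y := fun h => hxy (hf h)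
  have heq : (collinGraph f).inducedEdges S = Finset.powersetCard 3 S := by
    ext d
    simp only [RGraph.inducedEdges, Finset.mem_filter, mem_edges_collinGraph,
      Finset.mem_powersetCard]
    constructor
    · rintro ⟨⟨h1, -⟩, h3⟩
      exact ⟨h3, h1⟩
    · rintro ⟨h1, h3⟩
      exact ⟨⟨h3, fun a ha b hb c hc => Collin.of_line hfxy (hall a (h1 ha)) (hall b (h1 hb))
        (hall c (h1 hc))⟩, h1⟩
  rw [heq, Finset.card_powersetCard, hS] at h2
  exact absurd h2 (by decide)

theorem homNumber_collinGraph_lt {f : V → K × K} (hf : Function.Injective f) {k : ℕ} (hk : 0 < k)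
    (h : ∀ S : Finset V, HoldsOn (fun x y z => Collin (f x) (f y) (f z)) S ∨
      HoldsOn (fun x y z => ¬ Collin (f x) (f y) (f z)) S → S.card < k) :
    (collinGraph f).homNumber < k := by
  classical
  unfold RGraph.homNumber
  rw [Finset.sup_lt_iff (by exact hk)]
  intro S hS
  rcases (Finset.mem_filter.1 hS).2 with hS | hS
  · refine h S (Or.inl fun x hx y hy z hz hxy hxz hyz => ?_)
    refine (mem_edges_collinGraph.1 (hS {x, y, z} ?_ ?_)).2 x (by simp) y (by simp) z (by simp)
    · simp [Finset.insert_subset_iff, hx, hy, hz]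
    · exact Finset.card_eq_three.2 ⟨x, y, z, hxy, hxz, hyz, rfl⟩
  · refine h S (Or.inr fun x hx y hy z hz hxy hxz hyz hcol => ?_)
    have hc : ({x, y, z} : Finset V).card = 3 :=
      Finset.card_eq_three.2 ⟨x, y, z, hxy, hxz, hyz, rfl⟩
    refine hS {x, y, z} ?_ hc (mem_edges_collinGraph.2 ⟨hc, fun a ha b hb c hc => ?_⟩)
    · simp [Finset.insert_subset_iff, hx, hy, hz]
    · have hline : ∀ d ∈ ({x, y, z} : Finset V), Collin (f x) (f y) (f d) := by
        intro d hd
        simp only [Finset.mem_insert, Finset.mem_singleton] at hd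
        rcases hd with rfl | rfl | rfl
        · simp [Collin]
        · unfold Collin; ring
        · exact hcol
      exact Collin.of_line (fun h => hxy (hf h)) (hline a ha) (hline b hb) (hline c hc)

end CollinGraph

theorem minHomNumber_lt_of_plane {K : Type*} [Field K] [Fintype K] [DecidableEq K] {k n : ℕ}
    (hk : 0 < k) {W : Finset (K × K)} (hW : W.card = n)
    (h : ∀ S ⊆ W, HoldsOn Collin S ∨ HoldsOn (Compl3 Collin) S → S.card < k) :
    minHomNumber 3 n {(4, 2)} < k := by
  let e := W.equivFinOfCardEq hW
  let f : Fin n → K × K := fun i => (e.symm i : K × K)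
  have hf : Function.Injective f := fun i i' hii => e.symm.injective (Subtype.ext hii)
  refine (minHomNumber_le_homNumber _ (collinGraph_isFree hf)).trans_lt
    (homNumber_collinGraph_lt hf hk fun S hS => ?_)
  rw [← Finset.card_map ⟨f, hf⟩]
  have hsub : S.map ⟨f, hf⟩ ⊆ W := by
    intro x hx
    obtain ⟨i, -, rfl⟩ := Finset.mem_map.1 hx
    exact (e.symm i).2
  refine h _ hsub ?_
  have htrans : ∀ P : K × K → K × K → K × K → Prop,
      HoldsOn (fun x y z => P (f x) (f y) (f z)) S → HoldsOn P (S.map ⟨f, hf⟩) := by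
    intro P hP x hx y hy z hz hxy hxz hyz
    obtain ⟨a, ha, rfl⟩ := Finset.mem_map.1 hx
    obtain ⟨b, hb, rfl⟩ := Finset.mem_map.1 hy
    obtain ⟨c, hc, rfl⟩ := Finset.mem_map.1 hz
    exact hP a ha b hb c hc (fun h => hxy (h ▸ rfl)) (fun h => hxz (h ▸ rfl)) (fun h => hyz (h ▸ rfl))
  exact hS.imp (htrans Collin) (htrans (Compl3 Collin))

/-! ### Numerical estimates and choice of parameters. -/

/-- By C(D,k) ≤ (3D/k)^k, where 120 = 3 · 10 · 4. The spare factor 4^k is there to beat the number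
of containers. -/
theorem Nat.choose_mul_pow_le_of_mul_le {D q n k : ℕ} (hk : 0 < k) (hD : D ≤ 10 * q)
    (hkq : 120 * n ≤ k * q) : D.choose k * n ^ k * 4 ^ k ≤ (q ^ 2) ^ k := by
  have hk' : (0 : ℝ) < k := by exact_mod_cast hk
  have h1 : (D.choose k : ℝ) ≤ (D * 3 / k) ^ k := by
    calc (D.choose k : ℝ) ≤ (D : ℝ) ^ k / (k.factorial : ℝ) := Nat.choose_le_pow_div k D
      _ = (D / k : ℝ) ^ k * ((k : ℝ) ^ k / k.factorial) := by
        rw [div_pow]; field_simp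
      _ ≤ (D / k : ℝ) ^ k * Real.exp k := by
        gcongr
        exact Real.pow_div_factorial_le_exp _ hk'.le _
      _ = (D / k : ℝ) ^ k * (Real.exp 1) ^ k := by rw [← Real.exp_nat_mul, mul_one]
      _ ≤ (D / k : ℝ) ^ k * 3 ^ k := by
        gcongr
        exact Real.exp_one_lt_three.le
      _ = _ := by rw [← mul_pow]; ring
  have hD' : (D : ℝ) ≤ 10 * q := by exact_mod_cast hD
  have hkq' : 120 * (n : ℝ) ≤ k * q := by exact_mod_cast hkq
  have h2 : (D.choose k : ℝ) * n ^ k * 4 ^ k ≤ ((q : ℝ) ^ 2) ^ k := by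
    calc (D.choose k : ℝ) * n ^ k * 4 ^ k ≤ (D * 3 / k) ^ k * n ^ k * 4 ^ k := by gcongr
      _ = (D * 3 / k * n * 4 : ℝ) ^ k := by rw [mul_pow, mul_pow]
      _ ≤ _ := by
        gcongr
        calc (D * 3 / k * n * 4 : ℝ) ≤ (10 * q) * 3 / k * n * 4 := by gcongr
          _ = q * (120 * n) / k := by ring
          _ ≤ q * (k * q) / k := by gcongr
          _ = q ^ 2 := by field_simp
  exact_mod_cast h2

theorem Nat.pow_mul_pow_add_le {q t : ℕ} (hq : 2 ≤ q) (ht : 1 ≤ t) :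
    (q ^ 2) ^ t * (q ^ 2 + 1) ^ t + q ^ 4 ≤ q ^ (6 * t) := by
  have h1 : q ^ 2 + 1 ≤ q ^ 3 := by
    have : 2 * q ^ 2 ≤ q * q ^ 2 := Nat.mul_le_mul_right _ hq
    nlinarith
  have h2 : (q ^ 2) ^ t * (q ^ 2 + 1) ^ t ≤ q ^ (5 * t) := by
    rw [← mul_pow, pow_mul]
    refine Nat.pow_le_pow_left ?_ t
    calc q ^ 2 * (q ^ 2 + 1) ≤ q ^ 2 * q ^ 3 := Nat.mul_le_mul_left _ h1
      _ = q ^ 5 := by ring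
  have h3 : q ^ 4 ≤ q ^ (5 * t) := Nat.pow_le_pow_right (by omega) (by omega)
  calc _ ≤ q ^ (5 * t) + q ^ (5 * t) := Nat.add_le_add h2 h3
    _ = 2 * q ^ (5 * t) := by ring
    _ ≤ q ^ t * q ^ (5 * t) := Nat.mul_le_mul_right _ (hq.trans (Nat.le_self_pow (by omega) q))
    _ = _ := by rw [← pow_add]; congr 1; ring

theorem Nat.container_count_lt {q t k n : ℕ} (hq : 2 ≤ q) (ht : 1 ≤ t) (hk : 0 < k) (htq : t ≤ q)
    (hkq : 120 * n ≤ k * q) (hpow : q ^ (6 * t) < 4 ^ k) :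
    ((q ^ 2) ^ t * (q ^ 2 + 1) ^ t + q ^ 4) * (4 * (q + 1) + t + t).choose k * n ^ k <
      (q ^ 2) ^ k := by
  have h1 := Nat.choose_mul_pow_le_of_mul_le (D := 4 * (q + 1) + t + t) hk (by omega) hkq
  have h2 := (Nat.pow_mul_pow_add_le hq ht).trans_lt hpow
  rw [mul_assoc]
  generalize (4 * (q + 1) + t + t).choose k * n ^ k = M at h1 ⊢
  rcases Nat.eq_zero_or_pos M with rfl | h0
  · rw [mul_zero]
    exact pow_pos (pow_pos (by omega) 2) k
  · calc _ < 4 ^ k * M := Nat.mul_lt_mul_of_pos_right h2 h0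
      _ = M * 4 ^ k := mul_comm _ _
      _ ≤ _ := h1

/-- From 1 - x ≤ exp(-x): once t² is at least 4(q+1) log q, t container steps shrink the plane from
q² points to q. -/
theorem one_sub_div_pow_mul_sq_le {q : ℝ} {t : ℕ} (hq : 1 ≤ q) (htq : (t : ℝ) ≤ 4 * (q + 1))
    (h : Real.log q * (4 * (q + 1)) ≤ (t : ℝ) ^ 2) :
    (1 - t / (4 * (q + 1))) ^ t * q ^ 2 ≤ 4 * (q + 1) := by
  have hx : (t : ℝ) / (4 * (q + 1)) ≤ 1 := by
    rw [div_le_one (by positivity)]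
    exact htq
  have h1 : (1 - t / (4 * (q + 1))) ^ t ≤ q⁻¹ := by
    calc (1 - t / (4 * (q + 1))) ^ t ≤ (Real.exp (-(t / (4 * (q + 1))))) ^ t := by
          refine pow_le_pow_left₀ (by linarith) ?_ t
          linarith [Real.add_one_le_exp (-((t : ℝ) / (4 * (q + 1))))]
      _ = Real.exp (-(t ^ 2 / (4 * (q + 1)))) := by
        rw [← Real.exp_nat_mul]; congr 1; ring
      _ ≤ Real.exp (-Real.log q) := by
        gcongr
        rwa [le_div_iff₀ (by positivity)]
      _ = q⁻¹ := by rw [Real.exp_neg, Real.exp_log (by linarith)]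
  calc _ ≤ q⁻¹ * q ^ 2 := by gcongr
    _ = q := by field_simp
    _ ≤ _ := by linarith

/-- The parameters are q ≈ a²/L, a prime found by Bertrand's postulate, t ≈ 6a and k ≈ 120aL. Then
kq ≥ 120n, t² ≥ 36a² covers 8q log n ≤ 32a², and the container count q^(6t) is below 4^k as 42aL <
120aL. The condition L² ≤ a yields t ≤ q and n ≤ q². -/
theorem minHomNumber_lt_of_log_bounds {n : ℕ} {a l L : ℝ} (ha : a ^ 3 = n) (hl : l = Real.log n)
    (hl7 : 7 ≤ l) (hlL : l ≤ L) (hLa : L ^ 2 ≤ a) :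
    (minHomNumber 3 n {(4, 2)} : ℝ) < 121 * (a * L) := by
  have hL7 : 7 ≤ L := hl7.trans hlL
  have ha49 : 49 ≤ a := by nlinarith
  have hLpos : 0 < L := by linarith
  have hapos : 0 < a := by linarith
  have haL : 1 ≤ a * L := by nlinarith
  have hbase : a * L ≤ a ^ 2 / L := by
    rw [le_div_iff₀ hLpos]
    nlinarith
  obtain ⟨Q, hQ1, hQ2⟩ : ∃ Q : ℕ, a ^ 2 / L ≤ Q ∧ (Q : ℝ) < a ^ 2 / L + 1 :=
    ⟨⌈a ^ 2 / L⌉₊, Nat.le_ceil _, Nat.ceil_lt_add_one (by positivity)⟩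
  have hQ0 : Q ≠ 0 := by
    have : (0 : ℝ) < Q := by linarith
    exact_mod_cast this.ne'
  obtain ⟨q, hq, hQq, hqQ⟩ := Nat.exists_prime_lt_and_le_two_mul Q hQ0
  have : Fact q.Prime := ⟨hq⟩
  have hQq' : (Q : ℝ) ≤ q := by exact_mod_cast hQq.le
  have hqQ' : (q : ℝ) ≤ 2 * Q := by exact_mod_cast hqQ
  have hqlow : a ^ 2 / L ≤ q := hQ1.trans hQq'
  have hqaL : a * L ≤ q := hbase.trans hqlow
  have hqup : (q : ℝ) * L ≤ 4 * a ^ 2 := by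
    have : (q : ℝ) ≤ 4 * (a ^ 2 / L) := by linarith
    calc (q : ℝ) * L ≤ 4 * (a ^ 2 / L) * L := by gcongr
      _ = _ := by field_simp
  have hq7a : 7 * a ≤ q := by nlinarith
  have hq1 : (1 : ℝ) ≤ q := by linarith
  have hn0 : (0 : ℝ) < n := by rw [← ha]; positivity
  have hqn : (q : ℝ) ≤ n := by
    rw [← ha]
    have h1 : (q : ℝ) * 7 ≤ 4 * a ^ 2 := le_trans (by gcongr) hqup
    nlinarith [sq_nonneg a]
  have hlogq : Real.log q ≤ l := hl ▸ Real.log_le_log (by linarith) hqn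
  have hlogq0 : 0 ≤ Real.log q := Real.log_nonneg hq1
  obtain ⟨t, ht1, ht2⟩ : ∃ t : ℕ, 6 * a ≤ t ∧ (t : ℝ) ≤ 7 * a :=
    ⟨⌈6 * a⌉₊, Nat.le_ceil _,
      (Nat.ceil_lt_add_one (show 0 ≤ 6 * a by positivity)).le.trans (by linarith)⟩
  obtain ⟨k, hk1, hk2⟩ : ∃ k : ℕ, 120 * (a * L) ≤ k ∧ (k : ℝ) ≤ 121 * (a * L) :=
    ⟨⌈120 * (a * L)⌉₊, Nat.le_ceil _,
      (Nat.ceil_lt_add_one (show 0 ≤ 120 * (a * L) by positivity)).le.trans (by linarith)⟩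
  have htq : t ≤ q := by
    have : (t : ℝ) ≤ q := by linarith
    exact_mod_cast this
  have htk : t ≤ k := by
    have : (t : ℝ) ≤ k := by nlinarith
    exact_mod_cast this
  have hk3 : 3 ≤ k := by
    have : (3 : ℝ) ≤ k := by linarith
    exact_mod_cast this
  have ht0 : 1 ≤ t := by
    have : (1 : ℝ) ≤ t := by linarith
    exact_mod_cast this
  have hq2 : 2 ≤ q := hq.two_le
  have hnq : n ≤ q ^ 2 := by
    have h1 : (a * L) * (a ^ 2 / L) ≤ (q : ℝ) * q := by gcongr
    have h2 : (a * L) * (a ^ 2 / L) = a ^ 3 := by field_simp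
    have h3 : (n : ℝ) ≤ (q : ℝ) ^ 2 := by rw [← ha]; nlinarith
    exact_mod_cast h3
  have hkq : 120 * n ≤ k * q := by
    have h1 : 120 * (a * L) * (a ^ 2 / L) ≤ (k : ℝ) * q := by gcongr
    have h2 : 120 * (a * L) * (a ^ 2 / L) = 120 * a ^ 3 := by field_simp
    have h3 : 120 * (n : ℝ) ≤ (k : ℝ) * q := by rw [← ha]; linarith
    exact_mod_cast h3
  have hcontainer : (1 - t / (4 * ((q : ℝ) + 1)) : ℝ) ^ t * (q : ℝ) ^ 2 ≤ 4 * ((q : ℝ) + 1) := by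
    refine one_sub_div_pow_mul_sq_le hq1 (by linarith) ?_
    have h2 : (q : ℝ) * l ≤ 4 * a ^ 2 := le_trans (by gcongr) hqup
    calc Real.log q * (4 * ((q : ℝ) + 1)) ≤ l * (8 * q) := by gcongr ?_ * ?_; linarith
      _ ≤ (6 * a) ^ 2 := by nlinarith [sq_nonneg a]
      _ ≤ (t : ℝ) ^ 2 := by gcongr
  have hpow : q ^ (6 * t) < 4 ^ k := by
    have h1 : (6 * t : ℝ) * Real.log q < k * Real.log 4 := by
      have h4 : 1 ≤ Real.log 4 := by
        rw [Real.le_log_iff_exp_le (by norm_num)]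
        linarith [Real.exp_one_lt_three]
      calc (6 * t : ℝ) * Real.log q ≤ (6 * (7 * a)) * L := by
            gcongr
            exact hlogq.trans hlL
        _ < 120 * (a * L) := by nlinarith
        _ ≤ k * 1 := by linarith
        _ ≤ k * Real.log 4 := by gcongr
    have h2 : Real.log ((q : ℝ) ^ (6 * t)) < Real.log ((4 : ℝ) ^ k) := by
      rw [Real.log_pow, Real.log_pow]
      push_cast
      exact h1
    have h3 : (q : ℝ) ^ (6 * t) < (4 : ℝ) ^ k :=
      (Real.log_lt_log_iff (by positivity) (by positivity)).1 h2
    exact_mod_cast h3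
  have hcount := Nat.container_count_lt hq2 ht0 (by omega) htq hkq hpow
  obtain ⟨W, hW, h⟩ := exists_no_large_line_or_arc (K := ZMod q) (t := t) (j := t) (k := k) (n := n)
    hk3 htk (by rw [ZMod.card]; omega) (by rw [ZMod.card]; exact hcontainer)
    (by rw [ZMod.card]; exact hnq) (by rw [ZMod.card]; exact hcount)
  have h1 := minHomNumber_lt_of_plane (by omega : 0 < k) hW h
  have h2 : (minHomNumber 3 n {(4, 2)} : ℝ) < k := by exact_mod_cast h1
  linarith

theorem exists_minHomNumber_four_two_lt :
    ∃ c : ℝ, 0 < c ∧ ∀ n : ℕ, 2 ≤ n → (minHomNumber 3 n {(4, 2)} : ℝ) <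
      c * (n : ℝ) ^ (1 / 3 : ℝ) * Real.log (n : ℝ) ^ (4 / 3 : ℝ) := by
  have hlarge : ∀ᶠ n : ℕ in Filter.atTop, 7 ≤ Real.log (n : ℝ) ∧
      Real.log (n : ℝ) ^ (8 / 3 : ℝ) ≤ (n : ℝ) ^ (1 / 3 : ℝ) := by
    have h1 : ∀ᶠ x : ℝ in Filter.atTop, 7 ≤ Real.log x :=
      Real.tendsto_log_atTop.eventually_ge_atTop 7
    have h2 := (isLittleO_log_rpow_rpow_atTop (8 / 3 : ℝ) (s := 1 / 3) (by norm_num)).bound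
      one_pos
    filter_upwards [tendsto_natCast_atTop_atTop.eventually h1,
      tendsto_natCast_atTop_atTop.eventually h2] with n hn1 hn2
    refine ⟨hn1, (le_abs_self _).trans (hn2.trans (le_of_eq ?_))⟩
    rw [one_mul, Real.norm_of_nonneg (by positivity)]
  obtain ⟨n₀, hn₀⟩ := Filter.eventually_atTop.1 hlarge
  set m : ℝ := (2 : ℝ) ^ (1 / 3 : ℝ) * Real.log 2 ^ (4 / 3 : ℝ) with hm
  have hlog2 : 0 < Real.log 2 := Real.log_pos (by norm_num)
  have hmpos : 0 < m := by positivity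
  -- For n < n₀ the trivial bound n suffices, since m is the value at n = 2 of the increasing
  -- function n^(1/3) (log n)^(4/3).
  refine ⟨max 121 ((n₀ + 1) / m), by positivity, fun n hn => ?_⟩
  have hn2 : (2 : ℝ) ≤ n := by exact_mod_cast hn
  rcases le_or_gt n₀ n with h | h
  · obtain ⟨h7, h8⟩ := hn₀ n h
    have hl0 : (0 : ℝ) ≤ Real.log n := by linarith
    have := minHomNumber_lt_of_log_bounds (n := n) (a := (n : ℝ) ^ (1 / 3 : ℝ)) (l := Real.log n)
      (L := Real.log (n : ℝ) ^ (4 / 3 : ℝ)) (by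
        rw [← Real.rpow_natCast, ← Real.rpow_mul (by positivity)]; norm_num) rfl h7 (by
        nth_rewrite 1 [← Real.rpow_one (Real.log n)]
        exact Real.rpow_le_rpow_of_exponent_le (by linarith) (by norm_num)) (by
        rw [← Real.rpow_natCast, ← Real.rpow_mul hl0]
        convert h8 using 2
        norm_num)
    refine this.trans_le ?_
    rw [mul_assoc]
    gcongr
    exact le_max_left _ _
  · obtain ⟨H, -, hH⟩ := exists_homNumber_eq_minHomNumber n 4 2 two_ne_zero
    have h1 : (minHomNumber 3 n {(4, 2)} : ℝ) ≤ n := by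
      have := H.homNumber_le_card
      rw [hH, Fintype.card_fin] at this
      exact_mod_cast this
    have h2 : (n : ℝ) < n₀ + 1 := by
      have : (n : ℝ) < n₀ := by exact_mod_cast h
      linarith
    calc (minHomNumber 3 n {(4, 2)} : ℝ) < n₀ + 1 := h1.trans_lt h2
      _ = (n₀ + 1) / m * m := by field_simp
      _ ≤ max 121 ((n₀ + 1) / m) * m := by gcongr; exact le_max_right _ _
      _ ≤ max 121 ((n₀ + 1) / m) *
          ((n : ℝ) ^ (1 / 3 : ℝ) * Real.log (n : ℝ) ^ (4 / 3 : ℝ)) := by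
        rw [hm]; gcongr
      _ = _ := by ring

theorem proposition1p3 :
    ∃ c₁ c₂ : ℝ, 0 < c₁ ∧ 0 < c₂ ∧
      (∀ n : ℕ, 3 ≤ n →
        c₁ * (Real.log (n : ℝ) / Real.log (Real.log (n : ℝ))) ^ (1 / 2 : ℝ) <
          (minHomNumber 3 n {(4, 1)} : ℝ)) ∧
      (∀ n : ℕ, 2 ≤ n →
        (n : ℝ) ^ c₁ < (minHomNumber 3 n {(4, 2)} : ℝ) ∧
        (minHomNumber 3 n {(4, 2)} : ℝ) <
          c₂ * (n : ℝ) ^ (1 / 3 : ℝ) * Real.log (n : ℝ) ^ (4 / 3 : ℝ)) := by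
  obtain ⟨c, hc, h1⟩ := exists_lt_minHomNumber_four_one
  obtain ⟨c', hc', h2⟩ := exists_rpow_lt_minHomNumber_four_two
  obtain ⟨c₂, hc₂, h3⟩ := exists_minHomNumber_four_two_lt
  refine ⟨min c c', c₂, lt_min hc hc', hc₂, fun n hn => ?_, fun n hn => ⟨?_, h3 n hn⟩⟩
  · refine lt_of_le_of_lt ?_ (h1 n hn)
    have hn' : (3 : ℝ) ≤ n := by exact_mod_cast hn
    -- Since n ≥ 3 > e, the double logarithm is nonnegative, so decreasing the constant only weakens
    -- the bound.
    have hl : 1 ≤ Real.log n := by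
      rw [Real.le_log_iff_exp_le (by linarith)]
      linarith [Real.exp_one_lt_three]
    have := Real.log_nonneg hl
    gcongr
    exact min_le_left _ _
  · refine lt_of_le_of_lt ?_ (h2 n hn)
    have hn' : (1 : ℝ) ≤ n := by exact_mod_cast (by omega : 1 ≤ n)
    exact Real.rpow_le_rpow_of_exponent_le hn' (min_le_right _ _)
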